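/- Identify the first Heisenberg group $\mathbb H^1$ with $\mathbb R^3$, with points $(x,y,t)$, group law $$(x,y,t)\cdot(x',y',t')=\bigl(x+x',\,y+y',\,t+t'+2(yx'-xy')\bigr),$$ and left-invariant vector fields $X_1=\partial_x+2y\,\partial_t$, $X_2=\partial_y-2x\,\partial_t$. For a Lebesgue measurable set $E\subset\mathbb R^3$ and an open set $\Omega\subset\mathbb R^3$, the $\mathbb H$-perimeter of $E$ in $\Omega$ is $$\|\partial E\|_{\mathbb H}(\Omega)=\sup\Bigl\{\int_E (X_1^*\varphi_1+X_2^*\varphi_2)\,d\mathcal L^3 \;:\; \varphi=(\varphi_1,\varphi_2)\in C^1_c(\Omega;\mathbb R^2),\ |\varphi|\le 1\Bigr\}\in[0,\infty],$$ where $X_j^*=-X_j$ is the adjoint of $X_j$ in $L^2(\mathbb R^3)$ and $|\cdot|$ is the Euclidean norm. Write $A\Subset B$ if $\overline A$ is compact and $\overline A\subset B$. The set $E$ is a minimizer for the $\mathbb H$-perimeter in $\mathbb H^1$ if $\|\partial E\|_{\mathbb H}(\Omega')\le\|\partial F\|_{\mathbb H}(\Omega')$ for every open set $\Omega'\Subset\mathbb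 R^3$ and every Lebesgue measurable $F\subset\mathbb R^3$ with $E\,\Delta\,F\Subset\Omega'$. **Theorem 5.3 (Minimizers vs. stationary entire $X_1$-graphs).** Let $\phi:\mathbb R^2\to\mathbb R$ be of class $C^2$, and let $$S=\bigl\{(0,\eta,\tau)\cdot(\phi(\eta,\tau),0,0):(\eta,\tau)\in\mathbb R^2\bigr\},\qquad E=\bigl\{(x,y,t)\in\mathbb R^3: x<\phi(y,t-2xy)\bigr\}$$ be its $X_1$-graph and its $X_1$-subgraph. Suppose that $E$ is a minimizer for the $\mathbb H$-perimeter in $\mathbb H^1$. Then $S$ is a vertical plane, that is, a set of the form $\{(x,y,t): ax+by=d\}$ with $a,b,d\in\mathbb R$ and $(a,b)\neq(0,0)$; more precisely, there are constants $w,c\in\mathbb R$ with $\phi(\eta,\tau)=w\eta+c$ for all $(\eta,\tau)\in\mathbb R^2$. -/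

import Mathlib

open MeasureTheory Set
open scoped ENNReal symmDiff

namespace Heisenberg

/-- The underlying space `ℝ³` of the first Heisenberg group `ℍ¹`, with points `(x, y, t)`.
Topology, differentiable structure and Lebesgue measure are those of `ℝ × ℝ × ℝ`. The group law is
`Heisenberg.mul` below, and not the componentwise operation. -/
abbrev H1 : Type := ℝ × ℝ × ℝ

/-- The group law `(x,y,t)·(x',y',t') = (x+x', y+y', t+t'+2(yx'-xy'))`. -/
def mul (p q : H1) : H1 :=
  (p.1 + q.1, p.2.1 + q.2.1, p.2.2 + q.2.2 + 2 * (p.2.1 * q.1 - p.1 * q.2.1))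

/-- The first vector `e₁ = (1,0,0)` of the standard basis of `ℝ³`. -/
def e₁ : H1 := (1, 0, 0)

/-- The left-invariant vector field `X₁ = ∂_x + 2y ∂_t`, as a field of vectors of `ℝ³`. -/
def X₁ (p : H1) : H1 := (1, 0, 2 * p.2.1)

/-- The left-invariant vector field `X₂ = ∂_y - 2x ∂_t`, as a field of vectors of `ℝ³`. -/
def X₂ (p : H1) : H1 := (0, 1, -2 * p.1)

/-- The action `(V f)(p) = Df(p)[V(p)]` of a vector field `V` on a differentiable function `f`. -/
noncomputable def act (V : H1 → H1) (f : H1 → ℝ) (p : H1) : ℝ := fderiv ℝ f p (V p)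

/-- The horizontal divergence `X₁^* φ₁ + X₂^* φ₂`. The fields `X₁`, `X₂` have zero Euclidean
divergence, so that their adjoints in `L²(ℝ³)` are `X_j^* = -X_j`. -/
noncomputable def divX (φ : H1 → ℝ × ℝ) (p : H1) : ℝ :=
  -act X₁ (fun q => (φ q).1) p - act X₂ (fun q => (φ q).2) p

/-- The test fields: `φ ∈ C¹_c(Ω; ℝ²)` with Euclidean norm `|φ| ≤ 1` everywhere (functions with
compact support in `Ω` are extended by zero to `ℝ³`). -/
structure IsTestField (Ω : Set H1) (φ : H1 → ℝ × ℝ) : Prop where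
  contDiff : ContDiff ℝ 1 φ
  hasCompactSupport : HasCompactSupport φ
  tsupport_subset : tsupport φ ⊆ Ω
  norm_le_one : ∀ p, Real.sqrt ((φ p).1 ^ 2 + (φ p).2 ^ 2) ≤ 1

/-- The `ℍ`-perimeter of `E` in `Ω`: the supremum in `[0, ∞]` of `∫_E div_X φ` over all test
fields `φ`. The test field `0` gives the value `0`, so truncating negative values at `0` does not
change the supremum. -/
noncomputable def perimeter (E Ω : Set H1) : ℝ≥0∞ :=
  ⨆ (φ : H1 → ℝ × ℝ) (_ : IsTestField Ω φ), ENNReal.ofReal (∫ p in E, divX φ p)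

/-- `A ⋐ B`: the closure of `A` is compact and contained in `B`. -/
def CompactlyContained (A B : Set H1) : Prop := IsCompact (closure A) ∧ closure A ⊆ B

/-- `E` is a minimizer for the `ℍ`-perimeter in `Ω`: for every open `Ω' ⋐ Ω` and every Lebesgue
measurable `F ⊆ ℝ³` with `E Δ F ⋐ Ω'`, the perimeter of `E` in `Ω'` is at most that of `F`. -/
def IsPerimeterMinimizer (E Ω : Set H1) : Prop :=
  ∀ Ω' : Set H1, IsOpen Ω' → CompactlyContained Ω' Ω →
    ∀ F : Set H1, NullMeasurableSet F volume → CompactlyContained (E ∆ F) Ω' →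
      perimeter E Ω' ≤ perimeter F Ω'

/-- The (entire) `X₁`-graph `{(0,η,τ) · φ(η,τ) e₁ : (η,τ) ∈ ℝ²}` of `φ : ℝ² → ℝ`. -/
def X₁Graph (φ : ℝ × ℝ → ℝ) : Set H1 :=
  range fun a : ℝ × ℝ => mul (0, a.1, a.2) (φ a • e₁)

/-- The (entire) `X₁`-subgraph `{(x,y,t) : x < φ(y, t - 2xy)}` of `φ : ℝ² → ℝ`. -/
def X₁Subgraph (φ : ℝ × ℝ → ℝ) : Set H1 :=
  {p | p.1 < φ (p.2.1, p.2.2 - 2 * p.1 * p.2.1)}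

/-- A vertical plane: a set `{(x,y,t) : ax + by = c}` with `(a,b) ≠ (0,0)`. -/
def IsVerticalPlane (V : Set H1) : Prop :=
  ∃ a b c : ℝ, (a, b) ≠ (0, 0) ∧ V = {p : H1 | a * p.1 + b * p.2.1 = c}

end Heisenberg

namespace Heisenberg

/-! Write `w` for `burgers φ`. The perimeter of the subgraph over a plane domain `D` is the area
`∫_D √(1 + w²)` (`perimeter_cylinder_le`, `le_perimeter_cylinder`), so subgraphs of compactly
supported perturbations `φ + εψ` are competitors, and minimality yields the first and second
variations of this functional (`IsPerimeterMinimizer.variations`).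

The first variation says that `w` is constant along the integral curves of `∂_η - 4φ ∂_τ`. As `w` is
also the derivative of `φ` along them, these characteristics are parabolas on which `φ` is affine
(`along_curve`). They foliate the whole plane, indexed by their intersection `(0, s)` with the axis.
The Jacobian of the foliation is `J(η) = 1 - 4aη - 2bη²`, where `a` and `b` are the `τ`-derivatives
of `φ` and `w` at `(0, s)`; it never vanishes and `J(0) = 1`, so `J > 0` on all of `ℝ`
(`charJac_pos`).

The second variation decouples over the leaves, and after the substitution `u = χ / J` it reads `0 ≤
∫ χ'² / J + 4bχ² / J²` on each leaf. If `b < 0`, then `J` is bounded below by a positive constant,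
and wide cut-offs `χ` violate this (`nonneg_of_quadratic_stability`). If `b > 0`, or if `b = 0` and
`a ≠ 0`, then `J` is not positive everywhere (`eq_zero_of_quadratic_pos`). Hence `a = b = 0` for
every `s`: `φ` and `w` are constant on the axis, and following the leaves gives `φ = wη + c`. -/

/-- The Burgers operator `∂_η φ - 4 φ ∂_τ φ`. -/
noncomputable def burgers (φ : ℝ × ℝ → ℝ) (a : ℝ × ℝ) : ℝ :=
  fderiv ℝ φ a (1, 0) - 4 * φ a * fderiv ℝ φ a (0, 1)

/-- The parametrization `a ↦ (0, a) · φ(a) e₁` of the intrinsic graph of `φ`. -/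
def graphMap (φ : ℝ × ℝ → ℝ) (a : ℝ × ℝ) : H1 := (φ a, a.1, a.2 + 2 * φ a * a.1)

/-! ### Straightening the subgraph and the divergence formula -/

/-- Coordinates in which the `X₁`-subgraph of `φ` is the half-space `{q.1 < 0}`. -/
def straighten (φ : ℝ × ℝ → ℝ) (hφ : Continuous φ) : H1 ≃ₜ H1 where
  toFun q := (q.1 + φ q.2, q.2.1, q.2.2 + 2 * (q.1 + φ q.2) * q.2.1)
  invFun p := (p.1 - φ (p.2.1, p.2.2 - 2 * p.1 * p.2.1), p.2.1, p.2.2 - 2 * p.1 * p.2.1)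
  left_inv q := by simp
  right_inv p := by simp
  continuous_toFun := by fun_prop
  continuous_invFun := by fun_prop

theorem straighten_apply (φ : ℝ × ℝ → ℝ) (hφ : Continuous φ) (q : H1) :
    straighten φ hφ q = (q.1 + φ q.2, q.2.1, q.2.2 + 2 * (q.1 + φ q.2) * q.2.1) := rfl

/-- The map is a composition of two shears, each a translation in one variable by an amount
depending on the others. -/
theorem measurePreserving_straighten (φ : ℝ × ℝ → ℝ) (hφ : Continuous φ) :
    MeasurePreserving (straighten φ hφ) := by
  have h₁ : MeasurePreserving (fun q : ℝ × ℝ × ℝ => (q.1 + φ q.2, q.2)) := by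
    have h : MeasurePreserving (fun q : (ℝ × ℝ) × ℝ => (q.1, q.2 + φ q.1)) := by
      refine (MeasurePreserving.id (volume : Measure (ℝ × ℝ))).skew_product
        (g := fun a s => s + φ a) (by fun_prop) (Filter.Eventually.of_forall fun a => ?_)
      exact (measurePreserving_add_right volume (φ a)).map_eq
    exact (Measure.measurePreserving_swap.comp h).comp Measure.measurePreserving_swap
  have h₂ : MeasurePreserving (fun q : ℝ × ℝ × ℝ => (q.1, q.2.1, q.2.2 + 2 * q.1 * q.2.1)) := by
    refine (MeasurePreserving.id (volume : Measure ℝ)).skew_product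
      (g := fun (s : ℝ) (a : ℝ × ℝ) => (a.1, a.2 + 2 * s * a.1)) (by fun_prop)
      (Filter.Eventually.of_forall fun s => ?_)
    refine (MeasurePreserving.skew_product (MeasurePreserving.id (volume : Measure ℝ))
      (g := fun y t => t + 2 * s * y) (by fun_prop)
      (Filter.Eventually.of_forall fun y => ?_)).map_eq
    exact (measurePreserving_add_right volume (2 * s * y)).map_eq
  exact h₂.comp h₁

theorem straighten_preimage (φ : ℝ × ℝ → ℝ) (hφ : Continuous φ) :
    straighten φ hφ ⁻¹' X₁Subgraph φ = Iio 0 ×ˢ univ := by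
  ext q
  simp [straighten_apply, X₁Subgraph]

theorem setIntegral_X₁Subgraph (φ : ℝ × ℝ → ℝ) (hφ : Continuous φ) (g : H1 → ℝ) :
    ∫ p in X₁Subgraph φ, g p = ∫ q in Iio (0 : ℝ) ×ˢ (univ : Set (ℝ × ℝ)),
      g (straighten φ hφ q) := by
  rw [← straighten_preimage φ hφ]
  exact ((measurePreserving_straighten φ hφ).setIntegral_preimage_emb
    (straighten φ hφ).measurableEmbedding g _).symm

theorem _root_.HasCompactSupport.comp_prodMk_left {X Y : Type*} [TopologicalSpace X]
    [TopologicalSpace Y] [T2Space X] [T2Space Y] {u : X × Y → ℝ} (hu : HasCompactSupport u)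
    (a : Y) : HasCompactSupport fun s => u (s, a) := by
  refine HasCompactSupport.intro (hu.isCompact.image continuous_fst) fun s hs => ?_
  by_contra h
  exact hs ⟨(s, a), subset_tsupport _ h, rfl⟩

theorem _root_.HasCompactSupport.comp_prodMk_right {X Y : Type*} [TopologicalSpace X]
    [TopologicalSpace Y] [T2Space X] [T2Space Y] {u : X × Y → ℝ} (hu : HasCompactSupport u)
    (s : X) : HasCompactSupport fun a => u (s, a) := by
  refine HasCompactSupport.intro (hu.isCompact.image continuous_snd) fun a ha => ?_
  by_contra h
  exact ha ⟨(s, a), subset_tsupport _ h, rfl⟩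

theorem integral_fderiv_eq_zero {u : ℝ × ℝ → ℝ} (hu : ContDiff ℝ 1 u)
    (hc : HasCompactSupport u) (v : ℝ × ℝ) : ∫ a, fderiv ℝ u a v = 0 := by
  have hi : Integrable u := hu.continuous.integrable_of_hasCompactSupport hc
  have hi' : Integrable fun a => fderiv ℝ u a v :=
    ((hu.continuous_fderiv one_ne_zero).clm_apply continuous_const).integrable_of_hasCompactSupport
      (hc.fderiv_apply ℝ v)
  have := integral_mul_fderiv_eq_neg_fderiv_mul_of_integrable (μ := volume) (f := fun _ => (1 : ℝ))
    (g := u) (v := v) (by simp) (by simpa using hi') (by simpa using hi)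
    (fun x _ => differentiableAt_const _) (fun x _ => hu.differentiable one_ne_zero x)
  simpa using this

theorem setIntegral_halfSpace_of_hasDerivAt {u u' : ℝ × ℝ × ℝ → ℝ}
    (hc : HasCompactSupport u) (hu' : Continuous u') (hc' : HasCompactSupport u')
    (h : ∀ s a, HasDerivAt (fun s => u (s, a)) (u' (s, a)) s) :
    ∫ q in Iio (0 : ℝ) ×ˢ (univ : Set (ℝ × ℝ)), u' q = ∫ a, u (0, a) := by
  have hi : Integrable u' := hu'.integrable_of_hasCompactSupport hc'
  rw [Measure.volume_eq_prod, ← Measure.prod_restrict, Measure.restrict_univ, integral_prod_symm]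
  · refine integral_congr_ae (Filter.Eventually.of_forall fun a => ?_)
    have hd : deriv (fun s => u (s, a)) = fun s => u' (s, a) := funext fun s => (h s a).deriv
    have := HasCompactSupport.integral_Iic_deriv_eq (f := fun s => u (s, a))
      (contDiff_one_iff_deriv.2 ⟨fun s => (h s a).differentiableAt, by rw [hd]; fun_prop⟩)
      (hc.comp_prodMk_left a) 0
    rw [hd] at this
    simpa only [integral_Iic_eq_integral_Iio] using this
  · rw [← Measure.restrict_univ (μ := (volume : Measure (ℝ × ℝ))), Measure.prod_restrict]
    exact hi.integrableOn

theorem setIntegral_halfSpace_fderiv {u : ℝ × ℝ × ℝ → ℝ} (hu : ContDiff ℝ 1 u)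
    (hc : HasCompactSupport u) (v : ℝ × ℝ) :
    ∫ q in Iio (0 : ℝ) ×ˢ (univ : Set (ℝ × ℝ)), fderiv ℝ u q (0, v) = 0 := by
  have hi : Integrable fun q => fderiv ℝ u q (0, v) :=
    ((hu.continuous_fderiv one_ne_zero).clm_apply continuous_const).integrable_of_hasCompactSupport
      (hc.fderiv_apply ℝ _)
  rw [Measure.volume_eq_prod, ← Measure.prod_restrict, Measure.restrict_univ, integral_prod]
  · refine integral_eq_zero_of_ae (Filter.Eventually.of_forall fun s => ?_)
    have := integral_fderiv_eq_zero (u := fun a => u (s, a)) (by fun_prop)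
      (hc.comp_prodMk_right s) v
    refine (integral_congr_ae (Filter.Eventually.of_forall fun a => ?_)).trans this
    have h1 : HasFDerivAt (fun a : ℝ × ℝ => (s, a)) (ContinuousLinearMap.inr ℝ ℝ (ℝ × ℝ)) a :=
      hasFDerivAt_prodMk_right s a
    have h2 := (hu.differentiable one_ne_zero (s, a)).hasFDerivAt.comp a h1
    have h3 : fderiv ℝ (fun a => u (s, a)) a = _ := h2.fderiv
    simp [h3]
  · rw [← Measure.restrict_univ (μ := (volume : Measure (ℝ × ℝ))), Measure.prod_restrict]
    exact hi.integrableOn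

theorem hasFDerivAt_fst_add_comp_snd {φ : ℝ × ℝ → ℝ} (hφ : ContDiff ℝ 1 φ) (q : H1) :
    HasFDerivAt (fun q : H1 => q.1 + φ q.2) (ContinuousLinearMap.fst ℝ ℝ (ℝ × ℝ) +
      (fderiv ℝ φ q.2).comp (ContinuousLinearMap.snd ℝ ℝ (ℝ × ℝ))) q := by
  have hd : HasFDerivAt φ (fderiv ℝ φ q.2) q.2 := (hφ.differentiable one_ne_zero _).hasFDerivAt
  exact hasFDerivAt_fst.add (HasFDerivAt.comp q hd hasFDerivAt_snd)

theorem contDiff_straighten {φ : ℝ × ℝ → ℝ} (hφ : ContDiff ℝ 1 φ) :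
    ContDiff ℝ 1 (straighten φ hφ.continuous) := by
  have : (straighten φ hφ.continuous : H1 → H1) =
      fun q => (q.1 + φ q.2, q.2.1, q.2.2 + 2 * (q.1 + φ q.2) * q.2.1) := rfl
  rw [this]
  fun_prop

theorem fderiv_straighten_apply {φ : ℝ × ℝ → ℝ} (hφ : ContDiff ℝ 1 φ) (q v : H1) :
    fderiv ℝ (straighten φ hφ.continuous) q v =
      (v.1 + fderiv ℝ φ q.2 v.2, v.2.1, v.2.2 + 2 * (v.1 + fderiv ℝ φ q.2 v.2) * q.2.1 +
        2 * (q.1 + φ q.2) * v.2.1) := by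
  have h1 := hasFDerivAt_fst_add_comp_snd hφ q
  have h2 : HasFDerivAt (fun q : H1 => q.2.1) _ q :=
    ((ContinuousLinearMap.fst ℝ ℝ ℝ).comp (ContinuousLinearMap.snd ℝ ℝ (ℝ × ℝ))).hasFDerivAt
  have h3 : HasFDerivAt (fun q : H1 => q.2.2) _ q :=
    ((ContinuousLinearMap.snd ℝ ℝ ℝ).comp (ContinuousLinearMap.snd ℝ ℝ (ℝ × ℝ))).hasFDerivAt
  have h : HasFDerivAt (straighten φ hφ.continuous) _ q :=
    h1.prodMk (h2.prodMk (h3.add ((h1.const_mul 2).mul h2)))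
  rw [h.fderiv]
  ext <;> simp
  ring

theorem fderiv_comp_straighten {φ : ℝ × ℝ → ℝ} (hφ : ContDiff ℝ 1 φ) {g : H1 → ℝ}
    (hg : ContDiff ℝ 1 g) (q v : H1) :
    fderiv ℝ (fun q => g (straighten φ hφ.continuous q)) q v =
      fderiv ℝ g (straighten φ hφ.continuous q)
        (fderiv ℝ (straighten φ hφ.continuous) q v) := by
  have := fderiv_comp q (hg.differentiable one_ne_zero _)
    ((contDiff_straighten hφ).differentiable one_ne_zero q)
  simp only [Function.comp_def] at this
  rw [this]; rfl

theorem setIntegral_act_X₁ {φ : ℝ × ℝ → ℝ} (hφ : ContDiff ℝ 1 φ) {g : H1 → ℝ}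
    (hg : ContDiff ℝ 1 g) (hc : HasCompactSupport g) :
    ∫ p in X₁Subgraph φ, act X₁ g p = ∫ a, g (graphMap φ a) := by
  set Φ := straighten φ hφ.continuous with hΦ
  have hu : ContDiff ℝ 1 fun q => g (Φ q) := hg.comp (contDiff_straighten hφ)
  have huc : HasCompactSupport fun q => g (Φ q) := hc.comp_homeomorph Φ
  rw [setIntegral_X₁Subgraph φ hφ.continuous]
  have h := setIntegral_halfSpace_of_hasDerivAt (u := fun q => g (Φ q))
    (u' := fun q => fderiv ℝ (fun q => g (Φ q)) q (1, 0)) huc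
    ((hu.continuous_fderiv one_ne_zero).clm_apply continuous_const) (huc.fderiv_apply ℝ _)
    (fun s a => by
      have h1 : HasDerivAt (fun s : ℝ => (s, a)) (1, 0) s :=
        (hasDerivAt_id s).prodMk (hasDerivAt_const s a)
      exact HasFDerivAt.comp_hasDerivAt (l := fun q => g (Φ q)) s
        (hu.differentiable one_ne_zero (s, a)).hasFDerivAt h1)
  convert h using 2
  · ext q
    rw [fderiv_comp_straighten hφ hg, fderiv_straighten_apply hφ, act, X₁]
    simp [straighten_apply]
  · ext a; simp [hΦ, straighten_apply, graphMap]

/-- In straightened coordinates `X₂ g` becomes a full divergence `∂₁(c u) + ∂_η u + ∂_τ m`. The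
tangential terms integrate to zero on the half-space, and only the boundary value of `c u` survives,
where `c = -burgers φ`. -/
theorem setIntegral_act_X₂ {φ : ℝ × ℝ → ℝ} (hφ : ContDiff ℝ 1 φ) {g : H1 → ℝ}
    (hg : ContDiff ℝ 1 g) (hc : HasCompactSupport g) :
    ∫ p in X₁Subgraph φ, act X₂ g p = -∫ a, burgers φ a * g (graphMap φ a) := by
  set Φ := straighten φ hφ.continuous with hΦ
  set u : H1 → ℝ := fun q => g (Φ q) with hudef
  have hu : ContDiff ℝ 1 u := hg.comp (contDiff_straighten hφ)
  have huc : HasCompactSupport u := hc.comp_homeomorph Φ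
  have hcφ : Continuous φ := hφ.continuous
  have hcont (v) : Continuous fun q => fderiv ℝ u q v :=
    (hu.continuous_fderiv one_ne_zero).clm_apply continuous_const
  have hφη (v) : Continuous fun a => fderiv ℝ φ a v :=
    (hφ.continuous_fderiv one_ne_zero).clm_apply continuous_const
  -- the coefficient `c` makes `(c, 1, -4ξ)` the lift of `X₂`
  set c : H1 → ℝ := fun q =>
    -fderiv ℝ φ q.2 (1, 0) + 4 * (q.1 + φ q.2) * fderiv ℝ φ q.2 (0, 1) with hcdef
  have hcc : Continuous c := by
    have h1 := (hφη (1, 0)).comp (continuous_snd (X := ℝ))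
    have h2 := (hφη (0, 1)).comp (continuous_snd (X := ℝ))
    simp only [Function.comp_def] at h1 h2
    exact h1.neg.add ((by fun_prop : Continuous fun q : H1 => 4 * (q.1 + φ q.2)).mul h2)
  set m : H1 → ℝ := fun q => -4 * (q.1 + φ q.2) * u q with hm
  have hmd : ContDiff ℝ 1 m := by
    have : ContDiff ℝ 1 fun q : H1 => -4 * (q.1 + φ q.2) := by fun_prop
    exact this.mul hu
  have hmc : HasCompactSupport m := huc.mul_left
  -- `k` is `∂₁(c u)`; its zeroth-order term cancels the one created by moving the coefficient
  -- `-4(q.1 + φ)` inside `∂_τ`.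
  set k : H1 → ℝ := fun q => 4 * fderiv ℝ φ q.2 (0, 1) * u q + c q * fderiv ℝ u q (1, 0) with hk
  have hkc : HasCompactSupport k := by
    have := (HasCompactSupport.mul_left (f := fun q : H1 => 4 * fderiv ℝ φ q.2 (0, 1)) huc).add
      (HasCompactSupport.mul_left (f := c) (huc.fderiv_apply ℝ (1, 0)))
    exact this
  have hkcont : Continuous k := by
    have h2 := (hφη (0, 1)).comp (continuous_snd (X := ℝ))
    simp only [Function.comp_def] at h2
    exact ((continuous_const.mul h2).mul hu.continuous).add (hcc.mul (hcont _))
  have hA := setIntegral_halfSpace_of_hasDerivAt (u := fun q => c q * u q) (u' := k)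
    huc.mul_left hkcont hkc
    (fun s a => by
      have h1 : HasDerivAt (fun s : ℝ => (s, a)) (1, 0) s :=
        (hasDerivAt_id s).prodMk (hasDerivAt_const s a)
      have h2 := (hu.differentiable one_ne_zero (s, a)).hasFDerivAt.comp_hasDerivAt s h1
      have h3 : HasDerivAt (fun s => c (s, a)) (4 * fderiv ℝ φ a (0, 1)) s := by
        have := (((((hasDerivAt_id s).add_const (φ a)).const_mul 4).mul_const
          (fderiv ℝ φ a (0, 1)))).const_add (-fderiv ℝ φ a (1, 0))
        simpa [hcdef] using this
      exact h3.mul h2)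
  have hB := setIntegral_halfSpace_fderiv hu huc (1, 0)
  have hC := setIntegral_halfSpace_fderiv hmd hmc (0, 1)
  have key : ∀ q, act X₂ g (Φ q) = k q + (fderiv ℝ u q (0, (1, 0)) + fderiv ℝ m q (0, (0, 1))) := by
    intro q
    have e1 : fderiv ℝ m q (0, (0, 1)) = -4 * (q.1 + φ q.2) * fderiv ℝ u q (0, (0, 1))
        - 4 * fderiv ℝ φ q.2 (0, 1) * u q := by
      have h2 : HasFDerivAt m _ q :=
        ((hasFDerivAt_fst_add_comp_snd hφ q).const_mul (-4)).mul (hu.differentiable one_ne_zero q).hasFDerivAt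
      rw [h2.fderiv]
      simp
      ring
    have e2 : act X₂ g (Φ q) = c q * fderiv ℝ u q (1, 0) + fderiv ℝ u q (0, (1, 0))
        + -4 * (q.1 + φ q.2) * fderiv ℝ u q (0, (0, 1)) := by
      have : c q * fderiv ℝ u q (1, 0) + fderiv ℝ u q (0, (1, 0))
        + -4 * (q.1 + φ q.2) * fderiv ℝ u q (0, (0, 1)) =
          fderiv ℝ u q (c q, (1, -4 * (q.1 + φ q.2))) := by
        have : ((c q, (1, -4 * (q.1 + φ q.2))) : H1) = c q • ((1, 0) : H1) + (0, (1, 0)) +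
          (-4 * (q.1 + φ q.2)) • ((0, (0, 1)) : H1) := by ext <;> simp
        rw [this, map_add, map_add, map_smul, map_smul, smul_eq_mul, smul_eq_mul]
      rw [this, hudef, fderiv_comp_straighten hφ hg, fderiv_straighten_apply hφ, act, X₂]
      have h4 : fderiv ℝ φ q.2 (1, -4 * (q.1 + φ q.2)) = - c q := by
        have : ((1, -4 * (q.1 + φ q.2)) : ℝ × ℝ) = (1, 0) + (-4 * (q.1 + φ q.2)) • (0, 1) := by
          ext <;> simp
        rw [this, map_add, map_smul, smul_eq_mul, hcdef]; ring
      simp only [h4]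
      congr 1
      ext <;> simp [hΦ, straighten_apply]
      ring
    rw [e1, e2, hk]; ring
  rw [setIntegral_X₁Subgraph φ hφ.continuous]
  simp only [← hΦ, key]
  have i1 : Integrable k := hkcont.integrable_of_hasCompactSupport hkc
  have i2 : Integrable fun q => fderiv ℝ u q (0, (1, 0)) :=
    (hcont _).integrable_of_hasCompactSupport (huc.fderiv_apply ℝ _)
  have i3 : Integrable fun q => fderiv ℝ m q (0, (0, 1)) :=
    ((hmd.continuous_fderiv one_ne_zero).clm_apply continuous_const).integrable_of_hasCompactSupport
      (hmc.fderiv_apply ℝ _)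
  have e1 := integral_add (μ := volume.restrict (Iio (0 : ℝ) ×ˢ (univ : Set (ℝ × ℝ))))
    i1.integrableOn (i2.add i3).integrableOn
  simp only [Pi.add_apply] at e1
  rw [e1, integral_add i2.integrableOn i3.integrableOn, hA, hB, hC, ← integral_neg, add_zero, add_zero]
  congr 1 with a
  simp [hcdef, hudef, hΦ, straighten_apply, graphMap, burgers]
  ring

theorem continuous_graphMap {φ : ℝ × ℝ → ℝ} (hφ : Continuous φ) : Continuous (graphMap φ) := by
  unfold graphMap; fun_prop

theorem continuous_burgers {φ : ℝ × ℝ → ℝ} (hφ : ContDiff ℝ 1 φ) : Continuous (burgers φ) := by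
  have this (v : ℝ × ℝ) : Continuous fun a => fderiv ℝ φ a v :=
    (hφ.continuous_fderiv one_ne_zero).clm_apply continuous_const
  exact (this _).sub ((continuous_const.mul hφ.continuous).mul (this _))

theorem hasCompactSupport_comp_graphMap (φ : ℝ × ℝ → ℝ) {g : H1 → ℝ} (hc : HasCompactSupport g) :
    HasCompactSupport fun a => g (graphMap φ a) := by
  refine HasCompactSupport.intro (hc.isCompact.image
    (f := fun p : H1 => (p.2.1, p.2.2 - 2 * p.1 * p.2.1)) (by fun_prop)) fun a ha => ?_
  by_contra h
  exact ha ⟨graphMap φ a, subset_tsupport _ h, by simp [graphMap]⟩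

theorem setIntegral_divX {φ : ℝ × ℝ → ℝ} (hφ : ContDiff ℝ 1 φ) {f : H1 → ℝ × ℝ}
    (hf : ContDiff ℝ 1 f) (hc : HasCompactSupport f) :
    ∫ p in X₁Subgraph φ, divX f p =
      ∫ a, (burgers φ a * (f (graphMap φ a)).2 - (f (graphMap φ a)).1) := by
  have h1 : ContDiff ℝ 1 fun q => (f q).1 := hf.fst
  have h2 : ContDiff ℝ 1 fun q => (f q).2 := hf.snd
  have c1 : HasCompactSupport fun q => (f q).1 := hc.comp_left (g := Prod.fst) rfl
  have c2 : HasCompactSupport fun q => (f q).2 := hc.comp_left (g := Prod.snd) rfl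
  have aux {V : H1 → H1} (hV : Continuous V) {g : H1 → ℝ} (hg : ContDiff ℝ 1 g)
      (hc : HasCompactSupport g) : Integrable (act V g) := by
    refine ((hg.continuous_fderiv one_ne_zero).clm_apply hV).integrable_of_hasCompactSupport ?_
    refine (hc.fderiv ℝ).mono fun p hp h => hp ?_
    simp [h]
  have hX₁ : Continuous X₁ := by unfold X₁; fun_prop
  have hX₂ : Continuous X₂ := by unfold X₂; fun_prop
  have hΓ := continuous_graphMap hφ.continuous
  have e := integral_sub (μ := volume.restrict (X₁Subgraph φ))
    (aux hX₁ h1 c1).neg.integrableOn (aux hX₂ h2 c2).integrableOn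
  simp only [Pi.neg_apply] at e
  unfold divX
  rw [e, integral_neg,
    setIntegral_act_X₁ hφ h1 c1, setIntegral_act_X₂ hφ h2 c2, integral_sub]
  · ring
  · exact ((continuous_burgers hφ).mul (h2.continuous.comp hΓ)).integrable_of_hasCompactSupport
      (hasCompactSupport_comp_graphMap φ c2).mul_left
  · exact (h1.continuous.comp hΓ).integrable_of_hasCompactSupport
      (hasCompactSupport_comp_graphMap φ c1)

/-! ### Perimeter of a subgraph as an area integral -/

/-- The projection of `ℍ¹` along the integral lines of `X₁` to the plane `{x = 0}`. -/
def proj (p : H1) : ℝ × ℝ := (p.2.1, p.2.2 - 2 * p.1 * p.2.1)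

theorem contDiff_proj {n : WithTop ℕ∞} : ContDiff ℝ n proj := by unfold proj; fun_prop

theorem proj_graphMap (φ : ℝ × ℝ → ℝ) (a : ℝ × ℝ) : proj (graphMap φ a) = a := by
  simp [proj, graphMap]

theorem mem_X₁Subgraph {φ : ℝ × ℝ → ℝ} {p : H1} : p ∈ X₁Subgraph φ ↔ p.1 < φ (proj p) := Iff.rfl

/-- Points at height in `(-M, M)` along `X₁` over the ball of radius `R` in the plane `{x = 0}`. -/
def cylinder (M R : ℝ) : Set H1 := {p | p.1 ∈ Ioo (-M) M ∧ proj p ∈ Metric.ball 0 R}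

theorem isOpen_cylinder (M R : ℝ) : IsOpen (cylinder M R) :=
  (isOpen_Ioo.preimage continuous_fst).inter
    (Metric.isOpen_ball.preimage (contDiff_proj (n := 0)).continuous)

theorem isCompact_setOf_proj_mem {I : Set ℝ} {K : Set (ℝ × ℝ)} (hI : IsCompact I)
    (hK : IsCompact K) : IsCompact {p : H1 | p.1 ∈ I ∧ proj p ∈ K} := by
  have : {p : H1 | p.1 ∈ I ∧ proj p ∈ K} =
      (fun q : H1 => (q.1, q.2.1, q.2.2 + 2 * q.1 * q.2.1)) '' (I ×ˢ K) := by
    ext p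
    constructor
    · rintro ⟨h1, h2⟩
      exact ⟨(p.1, proj p), ⟨h1, h2⟩, by simp [proj]⟩
    · rintro ⟨q, ⟨h1, h2⟩, rfl⟩
      exact ⟨h1, by simpa [proj] using h2⟩
  rw [this]
  exact (hI.prod hK).image (by fun_prop)

theorem compactlyContained_cylinder (M R : ℝ) : CompactlyContained (cylinder M R) univ :=
  ⟨(isCompact_setOf_proj_mem isCompact_Icc (isCompact_closedBall 0 R)).closure_of_subset
    fun _ hp => ⟨Ioo_subset_Icc_self hp.1, Metric.ball_subset_closedBall hp.2⟩, subset_univ _⟩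

theorem graphMap_mem_cylinder {φ : ℝ × ℝ → ℝ} {M R : ℝ} {a : ℝ × ℝ} :
    graphMap φ a ∈ cylinder M R ↔ φ a ∈ Ioo (-M) M ∧ a ∈ Metric.ball 0 R := by
  simp only [cylinder, mem_ofPred_eq, proj_graphMap]
  rfl

theorem integrableOn_ball {g : ℝ × ℝ → ℝ} (hg : Continuous g) (R : ℝ) :
    IntegrableOn g (Metric.ball 0 R) :=
  (hg.continuousOn.integrableOn_compact (isCompact_closedBall 0 R)).mono_set
    Metric.ball_subset_closedBall

theorem continuous_sqrt_one_add_burgers_sq {φ : ℝ × ℝ → ℝ} (hφ : ContDiff ℝ 1 φ) :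
    Continuous fun a => Real.sqrt (1 + burgers φ a ^ 2) :=
  ((continuous_burgers hφ).pow 2 |>.const_add 1).sqrt

theorem perimeter_cylinder_le {φ : ℝ × ℝ → ℝ} (hφ : ContDiff ℝ 1 φ) (M R : ℝ) :
    perimeter (X₁Subgraph φ) (cylinder M R) ≤
      ENNReal.ofReal (∫ a in Metric.ball 0 R, Real.sqrt (1 + burgers φ a ^ 2)) := by
  refine iSup₂_le fun f hf => ENNReal.ofReal_le_ofReal ?_
  rw [setIntegral_divX hφ hf.contDiff hf.hasCompactSupport, ← integral_indicator
    Metric.isOpen_ball.measurableSet]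
  have hΓ := continuous_graphMap hφ.continuous
  have c1 : HasCompactSupport fun q => (f q).1 :=
    hf.hasCompactSupport.comp_left (g := Prod.fst) rfl
  have c2 : HasCompactSupport fun q => (f q).2 :=
    hf.hasCompactSupport.comp_left (g := Prod.snd) rfl
  refine integral_mono (Integrable.sub ?_ ?_) ?_ fun a => ?_
  · exact ((continuous_burgers hφ).mul
      (hf.contDiff.continuous.snd.comp hΓ)).integrable_of_hasCompactSupport
      (hasCompactSupport_comp_graphMap φ c2).mul_left
  · exact (hf.contDiff.continuous.fst.comp hΓ).integrable_of_hasCompactSupport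
      (hasCompactSupport_comp_graphMap φ c1)
  · exact (integrableOn_ball (continuous_sqrt_one_add_burgers_sq hφ) R).integrable_indicator
      Metric.isOpen_ball.measurableSet
  · by_cases ha : a ∈ Metric.ball (0 : ℝ × ℝ) R
    · rw [indicator_of_mem ha]
      refine Real.le_sqrt_of_sq_le ?_
      have h := hf.norm_le_one (graphMap φ a)
      rw [Real.sqrt_le_iff, one_pow] at h
      replace h := h.2
      -- Cauchy–Schwarz for `(-1, w)` and `f`, through Lagrange's identity: the defect is the square
      -- of `f₂ + w f₁`.
      nlinarith [sq_nonneg ((f (graphMap φ a)).2 + burgers φ a * (f (graphMap φ a)).1),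
        mul_nonneg (sq_nonneg (burgers φ a)) (sub_nonneg.2 h)]
    · rw [indicator_of_notMem ha]
      have : f (graphMap φ a) = 0 := by
        refine image_eq_zero_of_notMem_tsupport fun h => ha ?_
        exact (graphMap_mem_cylinder.1 (hf.tsupport_subset h)).2
      simp [this]

theorem contDiff_burgers {φ : ℝ × ℝ → ℝ} (hφ : ContDiff ℝ 2 φ) : ContDiff ℝ 1 (burgers φ) := by
  have (v : ℝ × ℝ) : ContDiff ℝ 1 fun a => fderiv ℝ φ a v :=
    (hφ.fderiv_right (m := 1) (by norm_num)).clm_apply contDiff_const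
  have h1 : ContDiff ℝ 1 φ := hφ.of_le (by norm_num)
  exact (this _).sub ((contDiff_const.mul h1).mul (this _))

/-- A calibration: the unit field in the direction `(-1, w)`, extended constantly along `X₁` and cut
off, almost attains equality in Cauchy–Schwarz. It must be `C¹`, which is why `φ` is `C²` here while
the upper bound needs only `C¹`. -/
theorem le_perimeter_cylinder_of_lt {φ : ℝ × ℝ → ℝ} (hφ : ContDiff ℝ 2 φ) {M₀ M r R : ℝ}
    (hM₀ : 0 < M₀) (hM : M₀ < M) (hr : 0 < r) (hR : r < R)
    (hφM : ∀ a ∈ Metric.ball 0 R, |φ a| ≤ M₀) :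
    ENNReal.ofReal (∫ a in Metric.ball 0 r, Real.sqrt (1 + burgers φ a ^ 2)) ≤
      perimeter (X₁Subgraph φ) (cylinder M R) := by
  have h1φ : ContDiff ℝ 1 φ := hφ.of_le (by norm_num)
  let χ : ContDiffBump (0 : ℝ × ℝ) := ⟨r, (r + R) / 2, hr, by linarith⟩
  -- This cut-off equals `1` at every height `|x| ≤ M₀`, so it is invisible on the graph.
  let h : ContDiffBump (0 : ℝ) := ⟨M₀, (M₀ + M) / 2, hM₀, by linarith⟩
  set w := burgers φ
  set s : ℝ × ℝ → ℝ := fun a => Real.sqrt (1 + w a ^ 2) with hs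
  have hs0 (a) : 0 < s a := Real.sqrt_pos.2 (by positivity)
  have hs2 (a) : s a ^ 2 = 1 + w a ^ 2 := Real.sq_sqrt (by positivity)
  have hwd : ContDiff ℝ 1 w := contDiff_burgers hφ
  have hsd : ContDiff ℝ 1 s := (contDiff_const.add (hwd.pow 2)).sqrt fun a => by positivity
  set V : ℝ × ℝ → ℝ × ℝ := fun a => (-(χ a / s a), χ a * w a / s a) with hV
  have hVd : ContDiff ℝ 1 V :=
    ((χ.contDiff.div hsd fun a => (hs0 a).ne').neg).prodMk
      ((χ.contDiff.mul hwd).div hsd fun a => (hs0 a).ne')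
  set f : H1 → ℝ × ℝ := fun p => h p.1 • V (proj p) with hf
  have hsub : tsupport f ⊆ {p | p.1 ∈ tsupport h ∧ proj p ∈ tsupport χ} := by
    refine closure_minimal (fun p hp => ?_) (((isClosed_tsupport h).preimage continuous_fst).inter
      ((isClosed_tsupport χ).preimage (contDiff_proj (n := 0)).continuous))
    refine ⟨subset_tsupport _ fun h0 => hp ?_, subset_tsupport _ fun h0 => hp ?_⟩
    · simp [hf, h0]
    · simp [hf, hV, h0]
  have htest : IsTestField (cylinder M R) f := by
    refine ⟨?_, ?_, ?_, fun p => ?_⟩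
    · exact (h.contDiff.comp contDiff_fst).smul (hVd.comp contDiff_proj)
    · exact (isCompact_setOf_proj_mem h.hasCompactSupport χ.hasCompactSupport).of_isClosed_subset
        (isClosed_tsupport _) hsub
    · refine hsub.trans fun p hp => ?_
      rw [mem_ofPred_eq, h.tsupport_eq, χ.tsupport_eq] at hp
      obtain ⟨h1, h2⟩ := hp
      refine ⟨?_, Metric.closedBall_subset_ball (by simp only [χ]; linarith) h2⟩
      rw [Metric.mem_closedBall, dist_zero_right, Real.norm_eq_abs] at h1
      exact abs_lt.1 (h1.trans_lt (by simp only [h]; linarith))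
    · rw [Real.sqrt_le_iff, one_pow]
      refine ⟨zero_le_one, ?_⟩
      set a := proj p
      have e : (f p).1 ^ 2 + (f p).2 ^ 2 = (h p.1 * χ a) ^ 2 * ((1 + w a ^ 2) / s a ^ 2) := by
        have : s a ≠ 0 := (hs0 a).ne'
        change (h p.1 * -(χ a / s a)) ^ 2 + (h p.1 * (χ a * w a / s a)) ^ 2 = _
        field_simp
      rw [e, hs2, div_self (by positivity), mul_one]
      have h1 := h.nonneg (x := p.1)
      have h2 := h.le_one (x := p.1)
      have h3 := χ.nonneg (x := a)
      have h4 := χ.le_one (x := a)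
      exact pow_le_one₀ (by positivity) (mul_le_one₀ h2 h3 h4)
  have hval (a : ℝ × ℝ) :
      w a * (f (graphMap φ a)).2 - (f (graphMap φ a)).1 = χ a * s a := by
    by_cases ha : a ∈ Metric.ball (0 : ℝ × ℝ) R
    · have hb : h (graphMap φ a).1 = 1 := by
        refine h.one_of_mem_closedBall ?_
        rw [Metric.mem_closedBall, dist_zero_right, Real.norm_eq_abs]
        exact hφM a ha
      have : s a ≠ 0 := (hs0 a).ne'
      simp only [hf, hV, hb, proj_graphMap, one_smul]
      field_simp
      rw [hs2]; ring
    · have : χ a = 0 := by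
        refine χ.zero_of_le_dist ?_
        rw [Metric.mem_ball, not_lt] at ha
        exact le_trans (by simp only [χ]; linarith) ha
      simp [hf, hV, proj_graphMap, this]
  refine le_trans (ENNReal.ofReal_le_ofReal ?_)
    (le_iSup₂ (f := fun f _ => ENNReal.ofReal (∫ p in X₁Subgraph φ, divX f p)) f htest)
  rw [setIntegral_divX h1φ htest.contDiff htest.hasCompactSupport]
  simp only [w] at hval
  simp only [hval]
  rw [← integral_indicator Metric.isOpen_ball.measurableSet]
  refine integral_mono ((integrableOn_ball hsd.continuous r).integrable_indicator
    Metric.isOpen_ball.measurableSet) ((χ.continuous.mul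
      hsd.continuous).integrable_of_hasCompactSupport χ.hasCompactSupport.mul_right) fun a => ?_
  by_cases ha : a ∈ Metric.ball (0 : ℝ × ℝ) r
  · simp only [indicator_of_mem ha]
    rw [χ.one_of_mem_closedBall (Metric.ball_subset_closedBall ha), one_mul]
  · simp only [indicator_of_notMem ha]
    exact mul_nonneg χ.nonneg (hs0 a).le

/-- Exhausting the ball by smaller concentric ones removes the loss due to the cut-off. -/
theorem le_perimeter_cylinder {φ : ℝ × ℝ → ℝ} (hφ : ContDiff ℝ 2 φ) {M₀ M R : ℝ}
    (hM₀ : 0 < M₀) (hM : M₀ < M) (hφM : ∀ a ∈ Metric.ball 0 R, |φ a| ≤ M₀) (hR : 0 < R) :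
    ENNReal.ofReal (∫ a in Metric.ball 0 R, Real.sqrt (1 + burgers φ a ^ 2)) ≤
      perimeter (X₁Subgraph φ) (cylinder M R) := by
  have h1φ : ContDiff ℝ 1 φ := hφ.of_le (by norm_num)
  obtain ⟨u, hu, hlt, hlim⟩ := exists_seq_strictMono_tendsto' hR
  have hU : ⋃ n, Metric.ball (0 : ℝ × ℝ) (u n) = Metric.ball 0 R := by
    ext a
    simp only [mem_iUnion, Metric.mem_ball]
    exact ⟨fun ⟨n, hn⟩ => hn.trans (hlt n).2, fun h =>
      ((hlim.eventually (lt_mem_nhds h)).exists)⟩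
  have ht := tendsto_setIntegral_of_monotone (μ := volume)
    (f := fun a => Real.sqrt (1 + burgers φ a ^ 2)) (s := fun n => Metric.ball (0 : ℝ × ℝ) (u n))
    (fun n => Metric.isOpen_ball.measurableSet)
    (fun m n hmn => Metric.ball_subset_ball (hu.monotone hmn))
    (by rw [hU]; exact integrableOn_ball (continuous_sqrt_one_add_burgers_sq h1φ) R)
  rw [hU] at ht
  exact le_of_tendsto (ENNReal.tendsto_ofReal ht) (Filter.Eventually.of_forall fun n =>
    le_perimeter_cylinder_of_lt hφ hM₀ hM (hlt n).1 (hlt n).2 hφM)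

/-! ### Graphical competitors and the variations of the area -/

theorem burgers_add {φ ψ : ℝ × ℝ → ℝ} (hφ : ContDiff ℝ 1 φ) (hψ : ContDiff ℝ 1 ψ) (a : ℝ × ℝ) :
    burgers (φ + ψ) a = burgers φ a + (fderiv ℝ ψ a (1, 0) - 4 * φ a * fderiv ℝ ψ a (0, 1)
      - 4 * ψ a * fderiv ℝ φ a (0, 1)) - 4 * ψ a * fderiv ℝ ψ a (0, 1) := by
  rw [burgers, burgers, fderiv_add (hφ.differentiable one_ne_zero a)
    (hψ.differentiable one_ne_zero a)]
  simp only [Pi.add_apply, add_apply]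
  ring

theorem burgers_add_of_notMem_tsupport {φ ψ : ℝ × ℝ → ℝ} (hφ : ContDiff ℝ 1 φ)
    (hψ : ContDiff ℝ 1 ψ) {a : ℝ × ℝ} (ha : a ∉ tsupport ψ) :
    burgers (φ + ψ) a = burgers φ a := by
  have h0 : ψ a = 0 := image_eq_zero_of_notMem_tsupport ha
  have h1 : fderiv ℝ ψ a = 0 :=
    image_eq_zero_of_notMem_tsupport fun h => ha (tsupport_fderiv_subset ℝ h)
  simp [burgers_add hφ hψ, h0, h1]

theorem IsPerimeterMinimizer.integral_sub_nonneg {φ : ℝ × ℝ → ℝ} (hφ : ContDiff ℝ 2 φ)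
    (hmin : IsPerimeterMinimizer (X₁Subgraph φ) univ) {ψ : ℝ × ℝ → ℝ} (hψ : ContDiff ℝ 1 ψ)
    (hc : HasCompactSupport ψ) :
    0 ≤ ∫ a, (Real.sqrt (1 + burgers (φ + ψ) a ^ 2) - Real.sqrt (1 + burgers φ a ^ 2)) := by
  have h1φ : ContDiff ℝ 1 φ := hφ.of_le (by norm_num)
  have hφψ : ContDiff ℝ 1 (φ + ψ) := h1φ.add hψ
  obtain ⟨R, hR, hsub⟩ := hc.isCompact.isBounded.subset_ball_lt 0 0
  obtain ⟨C, hC⟩ := (isCompact_closedBall (0 : ℝ × ℝ) R).exists_bound_of_continuousOn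
    h1φ.continuous.continuousOn
  obtain ⟨C', hC'⟩ := (isCompact_closedBall (0 : ℝ × ℝ) R).exists_bound_of_continuousOn
    hφψ.continuous.continuousOn
  -- The `1` only guarantees a positive radius for the cut-off in the height variable.
  set M₀ := max 1 (max C C') with hM₀
  have hM₀pos : 0 < M₀ := lt_max_of_lt_left one_pos
  have hb {a : ℝ × ℝ} (ha : a ∈ Metric.ball 0 R) : |φ a| ≤ M₀ :=
    (hC a (Metric.ball_subset_closedBall ha)).trans (by simp [hM₀])
  have hb' {a : ℝ × ℝ} (ha : a ∈ Metric.ball 0 R) : |(φ + ψ) a| ≤ M₀ :=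
    (hC' a (Metric.ball_subset_closedBall ha)).trans (by simp [hM₀])
  have hopen : IsOpen (X₁Subgraph (φ + ψ)) :=
    isOpen_lt continuous_fst (hφψ.continuous.comp (contDiff_proj (n := 0)).continuous)
  have hK := isCompact_setOf_proj_mem (isCompact_Icc (a := -M₀) (b := M₀)) hc.isCompact
  have hdiff : X₁Subgraph φ ∆ X₁Subgraph (φ + ψ) ⊆
      {p | p.1 ∈ Icc (-M₀) M₀ ∧ proj p ∈ tsupport ψ} := by
    intro p hp
    have hmem : proj p ∈ tsupport ψ := by
      by_contra h
      have h0 : ψ (proj p) = 0 := image_eq_zero_of_notMem_tsupport h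
      simp [mem_symmDiff, mem_X₁Subgraph, h0] at hp
      linarith [hp.1, hp.2]
    have h1 := abs_le.1 (hb (hsub hmem))
    have h2 := abs_le.1 (hb' (hsub hmem))
    refine ⟨?_, hmem⟩
    simp only [mem_symmDiff, mem_X₁Subgraph, not_lt] at hp
    rcases hp with hp | hp <;> constructor <;> linarith
  -- Height `M₀ + 1` leaves room both for that cut-off and for the closure of the symmetric
  -- difference.
  have hle := hmin (cylinder (M₀ + 1) R) (isOpen_cylinder _ _) (compactlyContained_cylinder _ _)
    (X₁Subgraph (φ + ψ)) hopen.measurableSet.nullMeasurableSet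
    ⟨hK.closure_of_subset hdiff, (closure_minimal hdiff hK.isClosed).trans fun p hp =>
      ⟨⟨by linarith [hp.1.1], by linarith [hp.1.2]⟩, hsub hp.2⟩⟩
  have hle' := (le_perimeter_cylinder hφ hM₀pos (lt_add_one M₀) (fun a => hb) hR).trans
    (hle.trans (perimeter_cylinder_le hφψ (M₀ + 1) R))
  rw [ENNReal.ofReal_le_ofReal_iff (integral_nonneg fun a => Real.sqrt_nonneg _)] at hle'
  rw [← setIntegral_eq_integral_of_forall_compl_eq_zero (s := Metric.ball 0 R), integral_sub
    (integrableOn_ball (continuous_sqrt_one_add_burgers_sq hφψ) R)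
    (integrableOn_ball (continuous_sqrt_one_add_burgers_sq h1φ) R)]
  · linarith
  · intro a ha
    rw [burgers_add_of_notMem_tsupport h1φ hψ fun h => ha (hsub h), sub_self]

/-- Second-order Taylor expansion with a cubic error that is uniform in `v`, so that it can be
integrated without differentiating under the integral. The proof squares both sides. -/
theorem sqrt_one_add_sq_add_le (v d : ℝ) :
    Real.sqrt (1 + (v + d) ^ 2) ≤ Real.sqrt (1 + v ^ 2) + v / Real.sqrt (1 + v ^ 2) * d +
      d ^ 2 / (2 * Real.sqrt (1 + v ^ 2) ^ 3) + |d| ^ 3 := by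
  set g := Real.sqrt (1 + v ^ 2) with hg
  have hg2 : g ^ 2 = 1 + v ^ 2 := Real.sq_sqrt (by positivity)
  have hg1 : 1 ≤ g := Real.one_le_sqrt.2 (by nlinarith)
  have hg0 : 0 < g := by linarith
  have hvg : |v| ≤ g := Real.abs_le_sqrt (by nlinarith)
  set S := g + v / g * d + d ^ 2 / (2 * g ^ 3) with hS
  have hS1 : g - |d| * (|v| / g) ≤ S := by
    have h1 : -(|d| * (|v| / g)) ≤ v / g * d := by
      have := neg_abs_le (v / g * d)
      rw [abs_mul, abs_div, abs_of_pos hg0] at this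
      linarith [mul_comm (|v| / g) |d|]
    have h2 : 0 ≤ d ^ 2 / (2 * g ^ 3) := by positivity
    linarith
  -- The square of the Taylor polynomial matches `1 + (v + d)²` up to order two in `d`.
  have hSsq : S ^ 2 = 1 + (v + d) ^ 2 + (v * d ^ 3 / g ^ 4 + d ^ 4 / (4 * g ^ 6)) := by
    have e : S ^ 2 = g ^ 2 + 2 * v * d + (v ^ 2 + 1) / g ^ 2 * d ^ 2 +
        (v * d ^ 3 / g ^ 4 + d ^ 4 / (4 * g ^ 6)) := by
      rw [hS]; field_simp; ring
    rw [e, show v ^ 2 + 1 = g ^ 2 by linarith, div_self (by positivity), hg2]; ring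
  have hrem : -|d| ^ 3 * (|v| / g) ≤ v * d ^ 3 / g ^ 4 + d ^ 4 / (4 * g ^ 6) := by
    have h1 : 0 ≤ d ^ 4 / (4 * g ^ 6) := by positivity
    have h2 : |v * d ^ 3 / g ^ 4| ≤ |d| ^ 3 * (|v| / g) := by
      rw [abs_div, abs_mul, abs_pow, abs_of_pos (by positivity : 0 < g ^ 4), mul_comm,
        mul_div_assoc]
      gcongr
      exact le_self_pow₀ hg1 (by norm_num)
    linarith [neg_abs_le (v * d ^ 3 / g ^ 4)]
  have hr : |v| / g ≤ 1 := (div_le_one hg0).2 hvg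
  have hr0 : 0 ≤ |v| / g := by positivity
  have hd := abs_nonneg d
  -- The second inequality absorbs the error of `hrem`. For `|d| ≤ 1` it follows from `3|v| ≤ 2(1 +
  -- v²)`; for `|d| ≥ 1` the cubic term dominates.
  have hfin : 0 ≤ S + |d| ^ 3 ∧ 0 ≤ -(|v| / g) + 2 * S + |d| ^ 3 := by
    rcases le_total |d| 1 with h | h
    · have h3 : g - |v| / g ≤ S := by nlinarith
      have h4 : 3 * (|v| / g) ≤ 2 * g := by
        rw [mul_div_assoc', div_le_iff₀ hg0]
        nlinarith [sq_nonneg (|v| - 1), sq_abs v]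
      have : 0 ≤ |d| ^ 3 := by positivity
      constructor <;> linarith
    · have h3 : g - |d| ≤ S := by nlinarith
      constructor
      · nlinarith [mul_nonneg hd (sub_nonneg.2 h), mul_nonneg (mul_nonneg hd hd) (sub_nonneg.2 h)]
      · nlinarith [mul_nonneg hd (sub_nonneg.2 h), mul_nonneg (mul_nonneg hd hd) (sub_nonneg.2 h)]
  refine Real.sqrt_le_iff.2 ⟨hfin.1, ?_⟩
  have : 0 ≤ |d| ^ 3 * (-(|v| / g) + 2 * S + |d| ^ 3) := mul_nonneg (by positivity) hfin.2
  nlinarith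

theorem eq_zero_and_nonneg_of_cubic_expansion {I₁ I₂ K : ℝ}
    (h : ∀ ε : ℝ, |ε| ≤ 1 → 0 ≤ ε * I₁ + ε ^ 2 * I₂ + |ε| ^ 3 * K) : I₁ = 0 ∧ 0 ≤ I₂ := by
  have key {a b c : ℝ} (hab : ∀ ε : ℝ, 0 < ε → ε ≤ 1 → 0 ≤ a + ε * b + ε ^ 2 * c) : 0 ≤ a := by
    have ht : Filter.Tendsto (fun ε : ℝ => a + ε * b + ε ^ 2 * c) (nhdsWithin 0 (Ioi 0))
        (nhds (a + 0 * b + 0 ^ 2 * c)) :=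
      (by fun_prop : Continuous fun ε : ℝ => a + ε * b + ε ^ 2 * c).continuousAt.tendsto.mono_left
        nhdsWithin_le_nhds
    have h0 : 0 ≤ a + 0 * b + 0 ^ 2 * c := by
      refine ge_of_tendsto ht ?_
      filter_upwards [Ioc_mem_nhdsGT (zero_lt_one' ℝ)] with ε hε
      exact hab ε hε.1 hε.2
    simpa using h0
  have h1 : 0 ≤ I₁ := key (b := I₂) (c := K) fun ε h0 h1 => by
    have := h ε (by rwa [abs_of_pos h0])
    rw [abs_of_pos h0] at this
    by_contra! hn
    nlinarith
  have h2 : 0 ≤ -I₁ := key (b := I₂) (c := K) fun ε h0 h1 => by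
    have := h (-ε) (by rwa [abs_neg, abs_of_pos h0])
    rw [abs_neg, abs_of_pos h0] at this
    by_contra! hn
    nlinarith
  have h3 : I₁ = 0 := by linarith
  refine ⟨h3, key (b := K) (c := 0) fun ε h0 h1 => ?_⟩
  have := h ε (by rwa [abs_of_pos h0])
  rw [abs_of_pos h0, h3] at this
  by_contra! hn
  nlinarith [pow_pos h0 2]

/-- The linearization of the Burgers operator at `φ`. -/
noncomputable def linBurgers (φ ψ : ℝ × ℝ → ℝ) (a : ℝ × ℝ) : ℝ :=
  fderiv ℝ ψ a (1, 0) - 4 * φ a * fderiv ℝ ψ a (0, 1) - 4 * ψ a * fderiv ℝ φ a (0, 1)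

/-- The area density `√(1 + (burgers φ)²)`. -/
noncomputable def density (φ : ℝ × ℝ → ℝ) (a : ℝ × ℝ) : ℝ := Real.sqrt (1 + burgers φ a ^ 2)

theorem density_pos (φ : ℝ × ℝ → ℝ) (a : ℝ × ℝ) : 0 < density φ a :=
  Real.sqrt_pos.2 (by positivity)

theorem continuous_density {φ : ℝ × ℝ → ℝ} (hφ : ContDiff ℝ 1 φ) : Continuous (density φ) :=
  continuous_sqrt_one_add_burgers_sq hφ

theorem continuous_fderiv_apply {φ : ℝ × ℝ → ℝ} (hφ : ContDiff ℝ 1 φ) (v : ℝ × ℝ) :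
    Continuous fun a => fderiv ℝ φ a v :=
  (hφ.continuous_fderiv one_ne_zero).clm_apply continuous_const

theorem continuous_linBurgers {φ ψ : ℝ × ℝ → ℝ} (hφ : ContDiff ℝ 1 φ) (hψ : ContDiff ℝ 1 ψ) :
    Continuous (linBurgers φ ψ) := by
  have h1 := continuous_fderiv_apply hφ (0, 1)
  have h2 := continuous_fderiv_apply hψ (0, 1)
  have h3 := continuous_fderiv_apply hψ (1, 0)
  have := hφ.continuous
  have := hψ.continuous
  unfold linBurgers
  fun_prop

theorem fderiv_eq_zero_of_notMem_tsupport {ψ : ℝ × ℝ → ℝ} {a : ℝ × ℝ} (ha : a ∉ tsupport ψ) :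
    fderiv ℝ ψ a = 0 :=
  image_eq_zero_of_notMem_tsupport fun h => ha (tsupport_fderiv_subset ℝ h)

theorem linBurgers_eq_zero {φ ψ : ℝ × ℝ → ℝ} {a : ℝ × ℝ} (ha : a ∉ tsupport ψ) :
    linBurgers φ ψ a = 0 := by
  simp [linBurgers, fderiv_eq_zero_of_notMem_tsupport ha, image_eq_zero_of_notMem_tsupport ha]

theorem burgers_add_smul {φ ψ : ℝ × ℝ → ℝ} (hφ : ContDiff ℝ 1 φ) (hψ : ContDiff ℝ 1 ψ) (ε : ℝ)
    (a : ℝ × ℝ) : burgers (φ + ε • ψ) a = burgers φ a + (ε * linBurgers φ ψ a +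
      ε ^ 2 * (-4 * ψ a * fderiv ℝ ψ a (0, 1))) := by
  have hεψ : ContDiff ℝ 1 (ε • ψ) := hψ.const_smul ε
  rw [burgers_add hφ hεψ, fderiv_const_smul (hψ.differentiable one_ne_zero a), linBurgers]
  simp only [Pi.smul_apply, smul_eq_mul, smul_apply]
  ring

/-- The Burgers operator is quadratic, so `burgers (φ + ε • ψ) = w + εL + ε²N` exactly. Inserting
this increment in the Taylor bound leaves an error `|ε|³ K` for `|ε| ≤ 1`, and the signs of the
lower coefficients follow. -/
theorem IsPerimeterMinimizer.variations {φ : ℝ × ℝ → ℝ} (hφ : ContDiff ℝ 2 φ)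
    (hmin : IsPerimeterMinimizer (X₁Subgraph φ) univ) {ψ : ℝ × ℝ → ℝ} (hψ : ContDiff ℝ 1 ψ)
    (hc : HasCompactSupport ψ) :
    ∫ a, burgers φ a / density φ a * linBurgers φ ψ a = 0 ∧
      0 ≤ ∫ a, (burgers φ a / density φ a * (-4 * ψ a * fderiv ℝ ψ a (0, 1)) +
        linBurgers φ ψ a ^ 2 / (2 * density φ a ^ 3)) := by
  have h1φ : ContDiff ℝ 1 φ := hφ.of_le (by norm_num)
  set w := burgers φ
  set g := density φ
  set L := linBurgers φ ψ
  set N : ℝ × ℝ → ℝ := fun a => -4 * ψ a * fderiv ℝ ψ a (0, 1) with hN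
  have hw : Continuous w := continuous_burgers h1φ
  have hg : Continuous g := continuous_density h1φ
  have hg0 (a) : 0 < g a := density_pos φ a
  have hL : Continuous L := continuous_linBurgers h1φ hψ
  have hNc : Continuous N :=
    (continuous_const.mul hψ.continuous).mul (continuous_fderiv_apply hψ _)
  have hLs {a} (ha : a ∉ tsupport ψ) : L a = 0 := linBurgers_eq_zero ha
  have hNs {a} (ha : a ∉ tsupport ψ) : N a = 0 := by
    simp [hN, image_eq_zero_of_notMem_tsupport ha]
  have integrable_of {u : ℝ × ℝ → ℝ} (hu : Continuous u) (h0 : ∀ a ∉ tsupport ψ, u a = 0) :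
      Integrable u :=
    hu.integrable_of_hasCompactSupport (HasCompactSupport.intro hc.isCompact h0)
  have hg3 : ∀ a, 2 * g a ^ 3 ≠ 0 := fun a => (by have := hg0 a; positivity)
  have i1 : Integrable fun a => w a / g a * L a :=
    integrable_of ((hw.div hg fun a => (hg0 a).ne').mul hL) fun a ha => by simp [hLs ha]
  have i2 : Integrable fun a => w a / g a * N a + L a ^ 2 / (2 * g a ^ 3) :=
    integrable_of (((hw.div hg fun a => (hg0 a).ne').mul hNc).add ((hL.pow 2).div (by fun_prop) hg3))
      fun a ha => by simp [hLs ha, hNs ha]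
  have i3 : Integrable fun a => (2 * |L a| * |N a| + N a ^ 2) / (2 * g a ^ 3) +
      (|L a| + |N a|) ^ 3 :=
    integrable_of ((Continuous.div (by fun_prop) (by fun_prop) hg3).add (by fun_prop))
      fun a ha => by simp [hLs ha, hNs ha]
  refine eq_zero_and_nonneg_of_cubic_expansion (K := ∫ a, ((2 * |L a| * |N a| + N a ^ 2) /
    (2 * g a ^ 3) + (|L a| + |N a|) ^ 3)) fun ε hε => ?_
  have hεψ : ContDiff ℝ 1 (ε • ψ) := hψ.const_smul ε
  have hεc : HasCompactSupport (ε • ψ) := hc.smul_left (f := fun _ => ε)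
  have i12 : Integrable fun a => ε * (w a / g a * L a) +
      ε ^ 2 * (w a / g a * N a + L a ^ 2 / (2 * g a ^ 3)) := (i1.const_mul _).add (i2.const_mul _)
  rw [← integral_const_mul, ← integral_const_mul, ← integral_const_mul,
    ← integral_add (i1.const_mul _) (i2.const_mul _),
    ← integral_add i12 (i3.const_mul _)]
  refine (hmin.integral_sub_nonneg hφ hεψ hεc).trans (integral_mono (integrable_of ?_ fun a ha => ?_)
    (i12.add (i3.const_mul _)) fun a => ?_)
  · exact (continuous_density (h1φ.add hεψ)).sub hg
  · rw [burgers_add_smul h1φ hψ, show linBurgers φ ψ a = 0 from hLs ha,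
      show -4 * ψ a * fderiv ℝ ψ a (0, 1) = 0 from hNs ha]
    simp
  · dsimp only [Pi.add_apply]
    rw [burgers_add_smul h1φ hψ]
    have ht := sqrt_one_add_sq_add_le (w a) (ε * L a + ε ^ 2 * N a)
    change Real.sqrt (1 + (w a + (ε * L a + ε ^ 2 * N a)) ^ 2) ≤ g a + w a / g a * _ +
      _ / (2 * g a ^ 3) + _ at ht
    change Real.sqrt (1 + (w a + (ε * L a + ε ^ 2 * N a)) ^ 2) - g a ≤ _
    have e0 := abs_nonneg ε
    have e2 : ε ^ 2 = |ε| ^ 2 := (sq_abs ε).symm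
    have e3 : |ε| ^ 4 ≤ |ε| ^ 3 := pow_le_pow_of_le_one e0 hε (by norm_num)
    have h2 : (ε * L a + ε ^ 2 * N a) ^ 2 ≤
        ε ^ 2 * L a ^ 2 + |ε| ^ 3 * (2 * |L a| * |N a| + N a ^ 2) := by
      have h5 : ε ^ 3 * (L a * N a) ≤ |ε| ^ 3 * (|L a| * |N a|) := by
        rw [← abs_pow, ← abs_mul, ← abs_mul]; exact le_abs_self _
      have h6 : ε ^ 4 * N a ^ 2 ≤ |ε| ^ 3 * N a ^ 2 := by
        rw [← (show Even 4 by decide).pow_abs]; gcongr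
      nlinarith
    have h3 : |ε * L a + ε ^ 2 * N a| ^ 3 ≤ |ε| ^ 3 * (|L a| + |N a|) ^ 3 := by
      rw [← mul_pow]
      gcongr
      calc |ε * L a + ε ^ 2 * N a| ≤ |ε * L a| + |ε ^ 2 * N a| := abs_add_le _ _
        _ = |ε| * |L a| + |ε| ^ 2 * |N a| := by rw [abs_mul, abs_mul, abs_pow]
        _ ≤ |ε| * |L a| + |ε| * |N a| := by
          gcongr; exact pow_le_of_le_one e0 hε two_ne_zero
        _ = _ := by ring
    have hp : 0 < 2 * g a ^ 3 := by have := hg0 a; positivity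
    have h4 := div_le_div_of_nonneg_right h2 hp.le
    rw [add_div, mul_div_assoc, mul_div_assoc] at h4
    linarith

/-! ### Euler–Lagrange equation and stability inequality -/

theorem hasDerivAt_div_sqrt_one_add_sq (v : ℝ) :
    HasDerivAt (fun v : ℝ => v / Real.sqrt (1 + v ^ 2)) (1 / Real.sqrt (1 + v ^ 2) ^ 3) v := by
  have h0 : 0 < Real.sqrt (1 + v ^ 2) := Real.sqrt_pos.2 (by positivity)
  have h2 : Real.sqrt (1 + v ^ 2) ^ 2 = 1 + v ^ 2 := Real.sq_sqrt (by positivity)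
  have hs : HasDerivAt (fun v : ℝ => Real.sqrt (1 + v ^ 2)) (v / Real.sqrt (1 + v ^ 2)) v := by
    have := ((hasDerivAt_pow 2 v).const_add 1).sqrt (by positivity)
    convert this using 1
    push_cast
    field_simp
  refine ((hasDerivAt_id' v).fun_div hs h0.ne').congr_deriv ?_
  field_simp
  rw [h2]; ring

theorem fderiv_burgers_div_density {φ : ℝ × ℝ → ℝ} (hφ : ContDiff ℝ 2 φ) (a v : ℝ × ℝ) :
    fderiv ℝ (fun a => burgers φ a / density φ a) a v =
      fderiv ℝ (burgers φ) a v / density φ a ^ 3 := by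
  have hw := ((contDiff_burgers hφ).differentiable one_ne_zero a).hasFDerivAt
  have h : HasFDerivAt (fun a => burgers φ a / density φ a) _ a :=
    (hasDerivAt_div_sqrt_one_add_sq (burgers φ a)).comp_hasFDerivAt a hw
  rw [h.fderiv]
  simp [density]
  ring

theorem integral_mul_fderiv_eq_neg {m u : ℝ × ℝ → ℝ} (hm : ContDiff ℝ 1 m) (hu : ContDiff ℝ 1 u)
    (hc : HasCompactSupport u) (v : ℝ × ℝ) :
    ∫ a, m a * fderiv ℝ u a v = -∫ a, fderiv ℝ m a v * u a := by
  refine integral_mul_fderiv_eq_neg_fderiv_mul_of_integrable ?_ ?_ ?_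
    (fun x _ => hm.differentiable one_ne_zero x) (fun x _ => hu.differentiable one_ne_zero x)
  · exact ((continuous_fderiv_apply hm v).mul hu.continuous).integrable_of_hasCompactSupport
      hc.mul_left
  · exact (hm.continuous.mul (continuous_fderiv_apply hu v)).integrable_of_hasCompactSupport
      (hc.fderiv_apply ℝ v).mul_left
  · exact (hm.continuous.mul hu.continuous).integrable_of_hasCompactSupport hc.mul_left

theorem contDiff_burgers_div_density {φ : ℝ × ℝ → ℝ} (hφ : ContDiff ℝ 2 φ) :
    ContDiff ℝ 1 fun a => burgers φ a / density φ a :=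
  (contDiff_burgers hφ).div ((contDiff_const.add ((contDiff_burgers hφ).pow 2)).sqrt
    fun a => by positivity) fun a => (density_pos φ a).ne'

/-- Since `linBurgers φ ψ = ψ_η - 4(φψ)_τ`, integration by parts turns the first variation into `m_η
- 4φ m_τ = 0` for `m = w / √(1 + w²)`. The derivative of `m` is that of `w` times a positive factor.
-/
theorem IsPerimeterMinimizer.transport_burgers {φ : ℝ × ℝ → ℝ} (hφ : ContDiff ℝ 2 φ)
    (hmin : IsPerimeterMinimizer (X₁Subgraph φ) univ) (a : ℝ × ℝ) :
    fderiv ℝ (burgers φ) a (1, 0) - 4 * φ a * fderiv ℝ (burgers φ) a (0, 1) = 0 := by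
  have h1φ : ContDiff ℝ 1 φ := hφ.of_le (by norm_num)
  set w := burgers φ with hwdef
  set g := density φ with hgdef
  set m : ℝ × ℝ → ℝ := fun a => w a / g a
  have hm : ContDiff ℝ 1 m := contDiff_burgers_div_density hφ
  set F : ℝ × ℝ → ℝ := fun a => fderiv ℝ m a (1, 0) - 4 * φ a * fderiv ℝ m a (0, 1) with hF
  have hFc : Continuous F := (continuous_fderiv_apply hm _).sub
    ((continuous_const.mul h1φ.continuous).mul (continuous_fderiv_apply hm _))
  have hF0 : F = 0 := by
    refine (Continuous.ae_eq_iff_eq volume hFc continuous_const).1 ?_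
    refine ae_eq_zero_of_integral_contDiff_smul_eq_zero hFc.locallyIntegrable fun ψ hψ' hc => ?_
    have hψ : ContDiff ℝ 1 ψ := hψ'.of_le (by exact_mod_cast le_top)
    have h := (hmin.variations hφ hψ hc).1
    have hφψ : ContDiff ℝ 1 fun a => φ a * ψ a := h1φ.mul hψ
    have hφψc : HasCompactSupport fun a => φ a * ψ a := hc.mul_left
    have e1 := integral_mul_fderiv_eq_neg hm hψ hc (1, 0)
    have e2 := integral_mul_fderiv_eq_neg hm hφψ hφψc (0, 1)
    have integrable_of {u : ℝ × ℝ → ℝ} (hu : Continuous u) (h0 : HasCompactSupport u) : Integrable u :=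
      hu.integrable_of_hasCompactSupport h0
    have hL (a) : w a / g a * linBurgers φ ψ a =
        m a * fderiv ℝ ψ a (1, 0) - 4 * (m a * fderiv ℝ (fun a => φ a * ψ a) a (0, 1)) := by
      rw [((h1φ.differentiable one_ne_zero a).hasFDerivAt.fun_mul
        (hψ.differentiable one_ne_zero a).hasFDerivAt).fderiv, linBurgers]
      simp [m]
      ring
    have hR (a) : ψ a • F a = fderiv ℝ m a (1, 0) * ψ a -
        4 * (fderiv ℝ m a (0, 1) * (φ a * ψ a)) := by
      simp [hF]; ring
    simp only [← hwdef, ← hgdef, hL] at h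
    rw [integral_sub, integral_const_mul, e1, e2] at h
    · simp only [hR]
      rw [integral_sub, integral_const_mul]
      · linarith
      · exact integrable_of ((continuous_fderiv_apply hm _).mul hψ.continuous) hc.mul_left
      · exact (integrable_of ((continuous_fderiv_apply hm _).mul hφψ.continuous)
          hφψc.mul_left).const_mul _
    · exact integrable_of (hm.continuous.mul (continuous_fderiv_apply hψ _)) (hc.fderiv_apply ℝ _).mul_left
    · exact (integrable_of (hm.continuous.mul (continuous_fderiv_apply hφψ _))
        (hφψc.fderiv_apply ℝ _).mul_left).const_mul _
  have h0 := congrFun hF0 a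
  simp only [hF, m, hwdef, hgdef, fderiv_burgers_div_density hφ, Pi.zero_apply] at h0
  have := density_pos φ a
  field_simp at h0
  linarith

/-- The term `-4ψψ_τ = -2(ψ²)_τ` is integrated by parts, and the result is doubled. -/
theorem IsPerimeterMinimizer.second_variation_nonneg {φ : ℝ × ℝ → ℝ} (hφ : ContDiff ℝ 2 φ)
    (hmin : IsPerimeterMinimizer (X₁Subgraph φ) univ) {ψ : ℝ × ℝ → ℝ} (hψ : ContDiff ℝ 1 ψ)
    (hc : HasCompactSupport ψ) :
    0 ≤ ∫ a, (linBurgers φ ψ a ^ 2 + 4 * fderiv ℝ (burgers φ) a (0, 1) * ψ a ^ 2) /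
      density φ a ^ 3 := by
  have h1φ : ContDiff ℝ 1 φ := hφ.of_le (by norm_num)
  have h := (hmin.variations hφ hψ hc).2
  have hm := contDiff_burgers_div_density hφ
  have hψ2 : ContDiff ℝ 1 fun a => ψ a ^ 2 := hψ.pow 2
  have hψ2c : HasCompactSupport fun a => ψ a ^ 2 := hc.comp_left (g := fun x => x ^ 2) (by simp)
  have e := integral_mul_fderiv_eq_neg hm hψ2 hψ2c (0, 1)
  simp only [fderiv_burgers_div_density hφ] at e
  have integrable_of {u : ℝ × ℝ → ℝ} (hu : Continuous u) (h0 : HasCompactSupport u) : Integrable u :=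
    hu.integrable_of_hasCompactSupport h0
  have hg3 : ∀ a, density φ a ^ 3 ≠ 0 := fun a => (by have := density_pos φ a; positivity)
  have hgc := (continuous_density h1φ).pow 3
  have i1 : Integrable fun a => burgers φ a / density φ a * fderiv ℝ (fun a => ψ a ^ 2) a (0, 1) :=
    integrable_of (hm.continuous.mul (continuous_fderiv_apply hψ2 _)) (hψ2c.fderiv_apply ℝ _).mul_left
  have i2 : Integrable fun a => linBurgers φ ψ a ^ 2 / density φ a ^ 3 :=
    integrable_of (((continuous_linBurgers h1φ hψ).pow 2).div hgc hg3)
      (HasCompactSupport.intro hc.isCompact fun a ha => by simp [linBurgers_eq_zero ha])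
  have i3 : Integrable fun a => fderiv ℝ (burgers φ) a (0, 1) / density φ a ^ 3 * ψ a ^ 2 :=
    integrable_of (((continuous_fderiv_apply (contDiff_burgers hφ) _).div hgc hg3).mul hψ2.continuous)
      hψ2c.mul_left
  have h1 (a) : burgers φ a / density φ a * (-4 * ψ a * fderiv ℝ ψ a (0, 1)) +
        linBurgers φ ψ a ^ 2 / (2 * density φ a ^ 3) =
      -2 * (burgers φ a / density φ a * fderiv ℝ (fun a => ψ a ^ 2) a (0, 1)) +
        1 / 2 * (linBurgers φ ψ a ^ 2 / density φ a ^ 3) := by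
    rw [((hψ.differentiable one_ne_zero a).hasFDerivAt.pow 2).fderiv]
    simp
    field_simp
    ring
  have h2 (a) : (linBurgers φ ψ a ^ 2 + 4 * fderiv ℝ (burgers φ) a (0, 1) * ψ a ^ 2) /
      density φ a ^ 3 = linBurgers φ ψ a ^ 2 / density φ a ^ 3 +
        4 * (fderiv ℝ (burgers φ) a (0, 1) / density φ a ^ 3 * ψ a ^ 2) := by
    have := density_pos φ a
    field_simp
  simp only [h1] at h
  simp only [h2]
  rw [integral_add (i1.const_mul _) (i2.const_mul _), integral_const_mul, integral_const_mul, e] at h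
  rw [integral_add i2 (i3.const_mul _), integral_const_mul]
  linarith

/-! ### Characteristic parabolas and the foliation of the plane -/

theorem eq_zero_of_norm_deriv_le_mul_norm {E : Type*} [NormedAddCommGroup E] [NormedSpace ℝ E]
    {f f' : ℝ → E} {K : ℝ → ℝ} (hK : Continuous K) (hf : ∀ t, HasDerivAt f (f' t) t)
    (hb : ∀ t, ‖f' t‖ ≤ K t * ‖f t‖) (h0 : f 0 = 0) (t : ℝ) : f t = 0 := by
  have key {f f' : ℝ → E} {K : ℝ → ℝ} (hK : Continuous K) (hf : ∀ t, HasDerivAt f (f' t) t)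
      (hb : ∀ t, ‖f' t‖ ≤ K t * ‖f t‖) (h0 : f 0 = 0) {t : ℝ} (ht : 0 ≤ t) : f t = 0 := by
    obtain ⟨C, hC⟩ := isCompact_Icc.exists_bound_of_continuousOn (s := Icc 0 t) hK.continuousOn
    refine eq_zero_of_abs_deriv_le_mul_abs_self_of_eq_zero_right (f' := f') (K := C)
      (fun x _ => (hf x).continuousAt.continuousWithinAt) (fun x _ => (hf x).hasDerivWithinAt) h0
      (fun x hx => (hb x).trans ?_) t ⟨ht, le_rfl⟩
    gcongr
    exact (le_abs_self _).trans (hC x (Ico_subset_Icc_self hx))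
  rcases le_total 0 t with ht | ht
  · exact key hK hf hb h0 ht
  · have := key (f := fun t => f (-t)) (f' := fun t => -f' (-t)) (K := fun t => K (-t))
      (by fun_prop) (fun t => by simpa [Function.comp_def] using (hf (-t)).scomp t (hasDerivAt_neg t))
      (fun t => by simpa using hb (-t)) (by simpa using h0) (t := -t) (by linarith)
    simpa using this

theorem fderiv_prod_apply (φ : ℝ × ℝ → ℝ) (a : ℝ × ℝ) (x y : ℝ) :
    fderiv ℝ φ a (x, y) = x * fderiv ℝ φ a (1, 0) + y * fderiv ℝ φ a (0, 1) := by
  have : ((x, y) : ℝ × ℝ) = x • (1, 0) + y • (0, 1) := by ext <;> simp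
  rw [this, map_add, map_smul, map_smul, smul_eq_mul, smul_eq_mul]

theorem hasDerivAt_comp_curve {φ : ℝ × ℝ → ℝ} (hφ : ContDiff ℝ 1 φ) {x y : ℝ → ℝ} {x' y' t : ℝ}
    (hx : HasDerivAt x x' t) (hy : HasDerivAt y y' t) :
    HasDerivAt (fun t => φ (x t, y t)) (x' * fderiv ℝ φ (x t, y t) (1, 0) +
      y' * fderiv ℝ φ (x t, y t) (0, 1)) t := by
  rw [← fderiv_prod_apply]
  exact HasFDerivAt.comp_hasDerivAt t (hφ.differentiable one_ne_zero _).hasFDerivAt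
    (hx.prodMk hy)

/-- The functions whose intrinsic gradient is constant along the characteristic lines. -/
structure IsCharacteristicallyAffine (φ : ℝ × ℝ → ℝ) : Prop where
  contDiff : ContDiff ℝ 2 φ
  transport : ∀ a, fderiv ℝ (burgers φ) a (1, 0) - 4 * φ a * fderiv ℝ (burgers φ) a (0, 1) = 0

/-- The value at `η = 0` of the characteristic line through `a`. -/
noncomputable def foot (φ : ℝ × ℝ → ℝ) (a : ℝ × ℝ) : ℝ :=
  a.2 + 4 * a.1 * φ a - 2 * a.1 ^ 2 * burgers φ a

/-- The characteristic line issuing from `(0, s)`. -/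
noncomputable def charLine (φ : ℝ × ℝ → ℝ) (η s : ℝ) : ℝ :=
  s - 4 * φ (0, s) * η - 2 * burgers φ (0, s) * η ^ 2

/-- The derivative of `charLine φ η s` in `s`. -/
noncomputable def charJac (φ : ℝ × ℝ → ℝ) (η s : ℝ) : ℝ :=
  1 - 4 * fderiv ℝ φ (0, s) (0, 1) * η - 2 * fderiv ℝ (burgers φ) (0, s) (0, 1) * η ^ 2

namespace IsCharacteristicallyAffine

variable {φ : ℝ × ℝ → ℝ}

theorem contDiff_one (h : IsCharacteristicallyAffine φ) : ContDiff ℝ 1 φ :=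
  h.contDiff.of_le (by norm_num)

theorem contDiff_burgers (h : IsCharacteristicallyAffine φ) : ContDiff ℝ 1 (burgers φ) :=
  Heisenberg.contDiff_burgers h.contDiff

/-- No flow has to be constructed: the candidate parabola is explicit, and the deviations of `φ` and
`w` from their predicted values along it vanish at `t = 0` and satisfy a linear differential
inequality of Grönwall type. -/
theorem along_curve (h : IsCharacteristicallyAffine φ) (a : ℝ × ℝ) (t : ℝ) :
    φ (a.1 + t, a.2 - 4 * φ a * t - 2 * burgers φ a * t ^ 2) = φ a + burgers φ a * t ∧
    burgers φ (a.1 + t, a.2 - 4 * φ a * t - 2 * burgers φ a * t ^ 2) = burgers φ a := by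
  set w := burgers φ with hw
  set c : ℝ → ℝ × ℝ := fun t => (a.1 + t, a.2 - 4 * φ a * t - 2 * w a * t ^ 2) with hc
  have hcc : Continuous c := by fun_prop
  have hx (t : ℝ) : HasDerivAt (fun t => a.1 + t) 1 t := (hasDerivAt_id' t).const_add _
  have hy (t : ℝ) : HasDerivAt (fun t => a.2 - 4 * φ a * t - 2 * w a * t ^ 2)
      (-4 * (φ a + w a * t)) t := by
    refine ((((hasDerivAt_id' t).const_mul (4 * φ a)).const_sub a.2).sub
      ((hasDerivAt_pow 2 t).const_mul (2 * w a))).congr_deriv ?_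
    push_cast
    ring
  have hφ' (t) := hasDerivAt_comp_curve h.contDiff_one (hx t) (hy t)
  have hw' (t) := hasDerivAt_comp_curve h.contDiff_burgers (hx t) (hy t)
  have hlin (t : ℝ) : HasDerivAt (fun t => φ a + w a * t) (w a) t := by
    simpa using ((hasDerivAt_id' t).const_mul (w a)).const_add (φ a)
  have hder (t) := ((hφ' t).sub (hlin t)).prodMk ((hw' t).sub_const (w a))
  have key := eq_zero_of_norm_deriv_le_mul_norm
    (K := fun t => 1 + 4 * |fderiv ℝ φ (c t) (0, 1)| + 4 * |fderiv ℝ w (c t) (0, 1)|)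
    ((((continuous_fderiv_apply h.contDiff_one (0, 1)).comp hcc).abs.const_mul 4 |>.const_add
      1).add (((continuous_fderiv_apply h.contDiff_burgers (0, 1)).comp hcc).abs.const_mul 4))
    hder (fun t => ?_) (by simp [hw]) t
  · have h1 := congrArg Prod.fst key
    have h2 := congrArg Prod.snd key
    simp only [Pi.sub_apply, Prod.fst_zero, Prod.snd_zero] at h1 h2
    exact ⟨by linarith, by linarith⟩
  · have e1 : w (c t) = fderiv ℝ φ (c t) (1, 0) - 4 * φ (c t) * fderiv ℝ φ (c t) (0, 1) := rfl
    have e2 := h.transport (c t)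
    rw [← hw] at e2
    change ‖(1 * fderiv ℝ φ (c t) (1, 0) + -4 * (φ a + w a * t) * fderiv ℝ φ (c t) (0, 1) - w a,
      1 * fderiv ℝ w (c t) (1, 0) + -4 * (φ a + w a * t) * fderiv ℝ w (c t) (0, 1))‖ ≤
      (1 + 4 * |fderiv ℝ φ (c t) (0, 1)| + 4 * |fderiv ℝ w (c t) (0, 1)|) *
        ‖(φ (c t) - (φ a + w a * t), w (c t) - w a)‖
    set p := φ (c t) - (φ a + w a * t) with hp
    set k := w (c t) - w a with hk
    set X := fderiv ℝ φ (c t) (0, 1)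
    set Y := fderiv ℝ w (c t) (0, 1)
    -- With `p`, `k` the deviations of `φ`, `w`, the system is `p' = k + 4Xp`, `k' = 4Yp`.
    have e3 : 1 * fderiv ℝ φ (c t) (1, 0) + -4 * (φ a + w a * t) * X - w a = k + 4 * X * p := by
      rw [hk, hp]; linear_combination -e1
    have e4 : 1 * fderiv ℝ w (c t) (1, 0) + -4 * (φ a + w a * t) * Y = 4 * Y * p := by
      rw [hp]; linear_combination e2
    rw [e3, e4]
    have n1 : |p| ≤ ‖(p, k)‖ := norm_fst_le (p, k)
    have n2 : |k| ≤ ‖(p, k)‖ := norm_snd_le (p, k)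
    have n0 : 0 ≤ ‖(p, k)‖ := norm_nonneg _
    have hX : |X| * |p| ≤ |X| * ‖(p, k)‖ := by gcongr
    have hY : |Y| * |p| ≤ |Y| * ‖(p, k)‖ := by gcongr
    have hX0 : 0 ≤ |X| * ‖(p, k)‖ := by positivity
    have hY0 : 0 ≤ |Y| * ‖(p, k)‖ := by positivity
    refine max_le ?_ ?_
    · have : |k + 4 * X * p| ≤ |k| + 4 * (|X| * |p|) := by
        refine (abs_add_le _ _).trans_eq ?_
        rw [abs_mul, abs_mul, abs_of_pos (four_pos : (0 : ℝ) < 4), mul_assoc]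
      change |k + 4 * X * p| ≤ _
      linarith
    · change |4 * Y * p| ≤ _
      rw [abs_mul, abs_mul, abs_of_pos (four_pos : (0 : ℝ) < 4), mul_assoc]
      linarith

theorem apply_foot (h : IsCharacteristicallyAffine φ) (a : ℝ × ℝ) :
    φ (0, foot φ a) = φ a - burgers φ a * a.1 ∧ burgers φ (0, foot φ a) = burgers φ a := by
  have := h.along_curve a (-a.1)
  have e : (a.1 + -a.1, a.2 - 4 * φ a * -a.1 - 2 * burgers φ a * (-a.1) ^ 2) =
      (0, foot φ a) := by
    ext <;> simp [foot]; ring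
  rw [e] at this
  exact ⟨by rw [this.1]; ring, this.2⟩

theorem apply_charLine (h : IsCharacteristicallyAffine φ) (η s : ℝ) :
    φ (η, charLine φ η s) = φ (0, s) + burgers φ (0, s) * η ∧
      burgers φ (η, charLine φ η s) = burgers φ (0, s) := by
  simpa [charLine] using h.along_curve (0, s) η

theorem foot_charLine (h : IsCharacteristicallyAffine φ) (η s : ℝ) :
    foot φ (η, charLine φ η s) = s := by
  obtain ⟨h1, h2⟩ := h.apply_charLine η s
  rw [foot, h1, h2, charLine]; ring

theorem charLine_foot (h : IsCharacteristicallyAffine φ) (a : ℝ × ℝ) :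
    charLine φ a.1 (foot φ a) = a.2 := by
  obtain ⟨h1, h2⟩ := h.apply_foot a
  rw [charLine, h1, h2, foot]; ring

theorem contDiff_foot (h : IsCharacteristicallyAffine φ) : ContDiff ℝ 1 (foot φ) := by
  have := h.contDiff_one
  have := h.contDiff_burgers
  unfold foot
  fun_prop

theorem transport_foot (h : IsCharacteristicallyAffine φ) (a : ℝ × ℝ) :
    fderiv ℝ (foot φ) a (1, 0) - 4 * φ a * fderiv ℝ (foot φ) a (0, 1) = 0 := by
  have hx : HasDerivAt (fun t => a.1 + t) 1 0 := (hasDerivAt_id' (0 : ℝ)).const_add _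
  have hy : HasDerivAt (fun t => a.2 - 4 * φ a * t - 2 * burgers φ a * t ^ 2) (-4 * φ a) 0 := by
    refine ((((hasDerivAt_id' (0 : ℝ)).const_mul (4 * φ a)).const_sub a.2).sub
      ((hasDerivAt_pow 2 (0 : ℝ)).const_mul (2 * burgers φ a))).congr_deriv ?_
    simp
  have h1 := hasDerivAt_comp_curve h.contDiff_foot hx hy
  have h2 : (fun t => foot φ (a.1 + t, a.2 - 4 * φ a * t - 2 * burgers φ a * t ^ 2)) =
      fun _ => foot φ a := by
    ext t
    obtain ⟨e1, e2⟩ := h.along_curve a t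
    rw [foot, e1, e2, foot]; ring
  rw [h2] at h1
  have := h1.unique (hasDerivAt_const _ _)
  simp only [add_zero, mul_zero, sub_zero, zero_pow two_ne_zero, Prod.mk.eta] at this
  linarith

theorem hasDerivAt_charLine (h : IsCharacteristicallyAffine φ) (η s : ℝ) :
    HasDerivAt (charLine φ η) (charJac φ η s) s := by
  have h1 := hasDerivAt_comp_curve h.contDiff_one (hasDerivAt_const s (0 : ℝ)) (hasDerivAt_id' s)
  have h2 := hasDerivAt_comp_curve h.contDiff_burgers (hasDerivAt_const s (0 : ℝ))
    (hasDerivAt_id' s)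
  refine ((((hasDerivAt_id' s).sub ((h1.const_mul 4).mul_const η))).sub
    ((h2.const_mul 2).mul_const (η ^ 2))).congr_deriv ?_
  rw [charJac]; ring

/-- Differentiate `foot φ (η, charLine φ η s) = s` in `s`. -/
theorem fderiv_foot_mul_charJac (h : IsCharacteristicallyAffine φ) (η s : ℝ) :
    fderiv ℝ (foot φ) (η, charLine φ η s) (0, 1) * charJac φ η s = 1 := by
  have h1 := hasDerivAt_comp_curve h.contDiff_foot (hasDerivAt_const s η)
    (h.hasDerivAt_charLine η s)
  simp only [h.foot_charLine] at h1
  linarith [h1.unique (hasDerivAt_id' s)]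

theorem fderiv_mul_charJac (h : IsCharacteristicallyAffine φ) (η s : ℝ) :
    fderiv ℝ φ (η, charLine φ η s) (0, 1) * charJac φ η s =
      fderiv ℝ φ (0, s) (0, 1) + fderiv ℝ (burgers φ) (0, s) (0, 1) * η := by
  have h1 := hasDerivAt_comp_curve h.contDiff_one (hasDerivAt_const s η)
    (h.hasDerivAt_charLine η s)
  simp only [(h.apply_charLine η _).1] at h1
  have h2 := (hasDerivAt_comp_curve h.contDiff_one (hasDerivAt_const s (0 : ℝ))
    (hasDerivAt_id' s)).add ((hasDerivAt_comp_curve h.contDiff_burgers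
      (hasDerivAt_const s (0 : ℝ)) (hasDerivAt_id' s)).mul_const η)
  linarith [h1.unique h2]

theorem fderiv_burgers_mul_charJac (h : IsCharacteristicallyAffine φ) (η s : ℝ) :
    fderiv ℝ (burgers φ) (η, charLine φ η s) (0, 1) * charJac φ η s =
      fderiv ℝ (burgers φ) (0, s) (0, 1) := by
  have h1 := hasDerivAt_comp_curve h.contDiff_burgers (hasDerivAt_const s η)
    (h.hasDerivAt_charLine η s)
  simp only [(h.apply_charLine η _).2] at h1
  have h2 := hasDerivAt_comp_curve h.contDiff_burgers
      (hasDerivAt_const s (0 : ℝ)) (hasDerivAt_id' s)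
  linarith [h1.unique h2]

/-- `J` equals `1` at `η = 0` and has no zero, being a factor of a product equal to `1`. This is
where it matters that the graph is entire. -/
theorem charJac_pos (h : IsCharacteristicallyAffine φ) (η s : ℝ) : 0 < charJac φ η s := by
  by_contra! hn
  have hc : Continuous fun η => charJac φ η s := by unfold charJac; fun_prop
  obtain ⟨x, hx⟩ := mem_range_of_exists_le_of_exists_ge (c := 0) hc ⟨η, hn⟩
    ⟨0, by simp [charJac]⟩
  have := h.fderiv_foot_mul_charJac x s
  simp only at hx
  rw [hx] at this
  simp at this

theorem continuous_fderiv_axis (h : IsCharacteristicallyAffine φ) :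
    Continuous fun s : ℝ => fderiv ℝ φ (0, s) (0, 1) :=
  (continuous_fderiv_apply h.contDiff_one (0, 1)).comp (by fun_prop : Continuous fun s : ℝ =>
    ((0, s) : ℝ × ℝ))

theorem continuous_fderiv_burgers_axis (h : IsCharacteristicallyAffine φ) :
    Continuous fun s : ℝ => fderiv ℝ (burgers φ) (0, s) (0, 1) :=
  (continuous_fderiv_apply h.contDiff_burgers (0, 1)).comp (by fun_prop : Continuous fun s : ℝ =>
    ((0, s) : ℝ × ℝ))

theorem continuous_charJac (h : IsCharacteristicallyAffine φ) :
    Continuous fun q : ℝ × ℝ => charJac φ q.1 q.2 := by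
  have h1 := h.continuous_fderiv_axis.comp (continuous_snd (X := ℝ))
  have h2 := h.continuous_fderiv_burgers_axis.comp (continuous_snd (X := ℝ))
  simp only [Function.comp_def] at h1 h2
  unfold charJac
  fun_prop

theorem continuous_charLine (h : IsCharacteristicallyAffine φ) :
    Continuous fun q : ℝ × ℝ => charLine φ q.1 q.2 := by
  have := h.contDiff_one.continuous
  have := h.contDiff_burgers.continuous
  unfold charLine
  fun_prop

theorem integral_eq_integral_charJac_mul (h : IsCharacteristicallyAffine φ) {F : ℝ × ℝ → ℝ}
    (hF : Integrable F) :
    ∫ a, F a = ∫ η, ∫ s, charJac φ η s * F (η, charLine φ η s) := by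
  rw [Measure.volume_eq_prod, integral_prod F hF]
  congr 1 with η
  have himg : charLine φ η '' univ = univ := by
    rw [image_univ, range_eq_univ]
    exact fun τ => ⟨foot φ (η, τ), h.charLine_foot (η, τ)⟩
  have := integral_image_eq_integral_abs_deriv_smul (f := charLine φ η) MeasurableSet.univ
    (fun s _ => (h.hasDerivAt_charLine η s).hasDerivWithinAt)
    (fun s _ s' _ hs => by rw [← h.foot_charLine η s, hs, h.foot_charLine])
    (fun τ => F (η, τ))
  simpa only [himg, setIntegral_univ, smul_eq_mul, abs_of_pos (h.charJac_pos η _)] using this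

end IsCharacteristicallyAffine

theorem IsPerimeterMinimizer.isCharacteristicallyAffine {φ : ℝ × ℝ → ℝ} (hφ : ContDiff ℝ 2 φ)
    (hmin : IsPerimeterMinimizer (X₁Subgraph φ) univ) : IsCharacteristicallyAffine φ :=
  ⟨hφ, hmin.transport_burgers hφ⟩

/-! ### Reduction of the second variation to a single characteristic -/

/-- The integrand of the second variation along the characteristic line issuing from `(0, s)`. -/
noncomputable def lineIntegrand (φ : ℝ × ℝ → ℝ) (u : ℝ → ℝ) (s η : ℝ) : ℝ :=
  (deriv u η * charJac φ η s - 4 * u η * (fderiv ℝ φ (0, s) (0, 1) +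
    fderiv ℝ (burgers φ) (0, s) (0, 1) * η)) ^ 2 / charJac φ η s +
    4 * fderiv ℝ (burgers φ) (0, s) (0, 1) * u η ^ 2

variable {φ : ℝ × ℝ → ℝ}

theorem IsCharacteristicallyAffine.continuous_lineIntegrand (h : IsCharacteristicallyAffine φ)
    {u : ℝ → ℝ} (hu : ContDiff ℝ 1 u) :
    Continuous fun q : ℝ × ℝ => lineIntegrand φ u q.1 q.2 := by
  have h1 := h.continuous_fderiv_axis.comp (continuous_fst (Y := ℝ))
  have h2 := h.continuous_fderiv_burgers_axis.comp (continuous_fst (Y := ℝ))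
  have h3 := h.continuous_charJac.comp continuous_swap
  have h4 := (hu.continuous_deriv le_rfl).comp (continuous_snd (X := ℝ))
  have h5 := hu.continuous
  simp only [Function.comp_def, Prod.fst_swap, Prod.snd_swap] at h1 h2 h3 h4
  unfold lineIntegrand
  exact (Continuous.div (by fun_prop) h3 fun q => (h.charJac_pos _ _).ne').add (by fun_prop)

theorem lineIntegrand_eq_zero {u : ℝ → ℝ} {s η : ℝ} (hη : η ∉ tsupport u) :
    lineIntegrand φ u s η = 0 := by
  have h1 : deriv u η = 0 :=
    image_eq_zero_of_notMem_tsupport fun h => hη (tsupport_deriv_subset h)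
  simp [lineIntegrand, h1, image_eq_zero_of_notMem_tsupport hη]

/-- For `ψ = u(η) θ(foot)` the factor `θ(foot)` is constant along characteristics, hence passes
through the transport part of `linBurgers`; the density is constant on each leaf because `w` is. -/
theorem IsCharacteristicallyAffine.second_variation_eq (h : IsCharacteristicallyAffine φ)
    {u θ : ℝ → ℝ} (hu : ContDiff ℝ 1 u) (hθ : ContDiff ℝ 1 θ) (η s : ℝ) :
    charJac φ η s * ((linBurgers φ (fun a => u a.1 * θ (foot φ a)) (η, charLine φ η s) ^ 2 +
      4 * fderiv ℝ (burgers φ) (η, charLine φ η s) (0, 1) *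
        (u η * θ (foot φ (η, charLine φ η s))) ^ 2) / density φ (η, charLine φ η s) ^ 3) =
    θ s ^ 2 / density φ (0, s) ^ 3 * lineIntegrand φ u s η := by
  set a : ℝ × ℝ := (η, charLine φ η s) with ha
  have hden : density φ a = density φ (0, s) := by
    rw [density, density, (h.apply_charLine η s).2]
  have hfoot : foot φ a = s := h.foot_charLine η s
  have hJ := h.charJac_pos η s
  have hd : HasFDerivAt (fun a : ℝ × ℝ => u a.1 * θ (foot φ a)) _ a :=
    (((hu.differentiable one_ne_zero a.1).hasDerivAt.comp_hasFDerivAt a hasFDerivAt_fst).fun_mul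
      ((hθ.differentiable one_ne_zero (foot φ a)).hasDerivAt.comp_hasFDerivAt a
        (h.contDiff_foot.differentiable one_ne_zero a).hasFDerivAt))
  have hL : linBurgers φ (fun a => u a.1 * θ (foot φ a)) a =
      θ s * (deriv u η - 4 * u η * fderiv ℝ φ a (0, 1)) := by
    rw [linBurgers, hd.fderiv]
    simp [hfoot]
    have := h.transport_foot a
    linear_combination u a.1 * deriv θ s * this
  have h1 := h.fderiv_mul_charJac η s
  have h2 := h.fderiv_burgers_mul_charJac η s
  have hd0 := density_pos φ (0, s)
  rw [hL, hden, hfoot, lineIntegrand, ← h1, ← h2, ← ha]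
  field_simp

theorem IsCharacteristicallyAffine.contDiff_and_hasCompactSupport_test (h : IsCharacteristicallyAffine φ)
    {u θ : ℝ → ℝ} (hu : ContDiff ℝ 1 u) (huc : HasCompactSupport u) (hθ : ContDiff ℝ 1 θ)
    (hθc : HasCompactSupport θ) :
    ContDiff ℝ 1 (fun a : ℝ × ℝ => u a.1 * θ (foot φ a)) ∧
      HasCompactSupport fun a : ℝ × ℝ => u a.1 * θ (foot φ a) := by
  refine ⟨(hu.comp contDiff_fst).mul (hθ.comp h.contDiff_foot), ?_⟩
  refine HasCompactSupport.intro ((huc.isCompact.prod hθc.isCompact).image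
    (f := fun q : ℝ × ℝ => (q.1, charLine φ q.1 q.2)) (continuous_fst.prodMk
      h.continuous_charLine)) fun a ha => ?_
  by_contra hn
  refine ha ⟨(a.1, foot φ a), ⟨subset_tsupport _ (left_ne_zero_of_mul hn),
    subset_tsupport _ (right_ne_zero_of_mul hn)⟩, ?_⟩
  ext
  · rfl
  · exact h.charLine_foot a

theorem IsCharacteristicallyAffine.integral_second_variation (h : IsCharacteristicallyAffine φ)
    {u θ : ℝ → ℝ} (hu : ContDiff ℝ 1 u) (huc : HasCompactSupport u) (hθ : ContDiff ℝ 1 θ)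
    (hθc : HasCompactSupport θ) :
    ∫ a, (linBurgers φ (fun a => u a.1 * θ (foot φ a)) a ^ 2 +
      4 * fderiv ℝ (burgers φ) a (0, 1) * (u a.1 * θ (foot φ a)) ^ 2) / density φ a ^ 3 =
    ∫ s, θ s ^ 2 / density φ (0, s) ^ 3 * ∫ η, lineIntegrand φ u s η := by
  obtain ⟨hψ, hψc⟩ := h.contDiff_and_hasCompactSupport_test hu huc hθ hθc
  have hρ : Continuous fun s : ℝ => density φ (0, s) :=
    (continuous_density h.contDiff_one).comp (by fun_prop : Continuous fun s : ℝ =>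
      ((0, s) : ℝ × ℝ))
  have hden (a : ℝ × ℝ) : density φ a ^ 3 ≠ 0 := by have := density_pos φ a; positivity
  rw [h.integral_eq_integral_charJac_mul]
  · simp only [h.second_variation_eq hu hθ]
    rw [integral_integral_swap]
    · simp only [integral_const_mul]
    · refine Continuous.integrable_of_hasCompactSupport ?_
        (HasCompactSupport.intro (huc.isCompact.prod hθc.isCompact) fun q hq => ?_)
      · exact (((hθ.continuous.comp continuous_snd).pow 2).div ((hρ.comp continuous_snd).pow 3)
          fun q => hden _).mul ((h.continuous_lineIntegrand hu).comp continuous_swap)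
      · rw [mem_prod, not_and_or] at hq
        rcases hq with hq | hq
        · simp [Function.uncurry, lineIntegrand_eq_zero hq]
        · simp [Function.uncurry, image_eq_zero_of_notMem_tsupport hq]
  · refine Continuous.integrable_of_hasCompactSupport ?_
      (HasCompactSupport.intro hψc.isCompact fun a ha => ?_)
    · exact (((continuous_linBurgers h.contDiff_one hψ).pow 2).add ((continuous_const.mul
        (continuous_fderiv_apply h.contDiff_burgers _)).mul (hψ.continuous.pow 2))).div
        ((continuous_density h.contDiff_one).pow 3) hden
    · have h0 : u a.1 * θ (foot φ a) = 0 :=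
        image_eq_zero_of_notMem_tsupport (f := fun a => u a.1 * θ (foot φ a)) ha
      rw [linBurgers_eq_zero ha, h0]
      simp

/-- The line integral is continuous in `s`; were it negative somewhere, a bump `θ` concentrated
there would make the second variation negative. -/
theorem IsPerimeterMinimizer.integral_lineIntegrand_nonneg (hφ : ContDiff ℝ 2 φ)
    (hmin : IsPerimeterMinimizer (X₁Subgraph φ) univ) {u : ℝ → ℝ} (hu : ContDiff ℝ 1 u)
    (huc : HasCompactSupport u) (s : ℝ) : 0 ≤ ∫ η, lineIntegrand φ u s η := by
  have h := hmin.isCharacteristicallyAffine hφ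
  have hcont : Continuous fun s => ∫ η, lineIntegrand φ u s η := by
    have := continuous_parametric_integral_of_continuous (μ := volume)
      (f := fun s η => lineIntegrand φ u s η) (h.continuous_lineIntegrand hu) huc.isCompact
    refine this.congr fun s => setIntegral_eq_integral_of_forall_compl_eq_zero fun η hη =>
      lineIntegrand_eq_zero hη
  have hρ : Continuous fun s : ℝ => density φ (0, s) :=
    (continuous_density h.contDiff_one).comp (by fun_prop : Continuous fun s : ℝ =>
      ((0, s) : ℝ × ℝ))
  by_contra! hn
  obtain ⟨r, hr, hball⟩ := Metric.eventually_nhds_iff_ball.1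
    (hcont.continuousAt.eventually_lt continuousAt_const hn)
  let θ : ContDiffBump s := ⟨r / 2, r, by linarith, by linarith⟩
  have hθ : ContDiff ℝ 1 θ := θ.contDiff
  obtain ⟨hψ, hψc⟩ := h.contDiff_and_hasCompactSupport_test hu huc hθ θ.hasCompactSupport
  have h2 := hmin.second_variation_nonneg hφ hψ hψc
  rw [h.integral_second_variation hu huc hθ θ.hasCompactSupport] at h2
  set G : ℝ → ℝ := fun s => θ s ^ 2 / density φ (0, s) ^ 3 * ∫ η, lineIntegrand φ u s η with hG
  have hGc : Continuous G := ((hθ.continuous.pow 2).div (hρ.pow 3) fun s =>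
    (pow_pos (density_pos φ (0, s)) 3).ne').mul hcont
  have hGs : HasCompactSupport G := HasCompactSupport.intro θ.hasCompactSupport.isCompact
    fun s hs => by simp [hG, image_eq_zero_of_notMem_tsupport hs]
  have hG0 (x : ℝ) : G x ≤ 0 := by
    by_cases hx : x ∈ Metric.ball s r
    · have := density_pos φ (0, x)
      exact mul_nonpos_of_nonneg_of_nonpos (by positivity) (hball x hx).le
    · have : θ x = 0 := θ.zero_of_le_dist (by simpa using hx)
      simp [hG, this]
  have hGneg : 0 < -G s := by
    have h1 : θ s = 1 := θ.one_of_mem_closedBall (Metric.mem_closedBall_self (by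
      simp only [θ]; linarith))
    have := density_pos φ (0, s)
    rw [hG, neg_pos]
    simp only [h1]
    exact mul_neg_of_pos_of_neg (by positivity) hn
  have := hGc.neg.integral_pos_of_hasCompactSupport_nonneg_nonzero (μ := volume) hGs.neg
    (fun x => neg_nonneg.2 (hG0 x)) hGneg.ne'
  have e : ∫ x, (-G) x = -∫ x, G x := integral_neg _
  rw [e] at this
  change 0 ≤ ∫ x, G x at h2
  linarith

/-! ### One-dimensional stability analysis and conclusion -/

theorem nonneg_of_quadratic_stability {a b : ℝ} (hP : ∀ x : ℝ, 0 < 1 - 4 * a * x - 2 * b * x ^ 2)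
    (hS : ∀ χ : ℝ → ℝ, ContDiff ℝ 1 χ → HasCompactSupport χ →
      0 ≤ ∫ x, (deriv χ x ^ 2 / (1 - 4 * a * x - 2 * b * x ^ 2) +
        4 * b * χ x ^ 2 / (1 - 4 * a * x - 2 * b * x ^ 2) ^ 2)) : 0 ≤ b := by
  by_contra! hb
  set P : ℝ → ℝ := fun x => 1 - 4 * a * x - 2 * b * x ^ 2 with hPdef
  have hPc : Continuous P := by fun_prop
  -- For `b < 0` the parabola `P` opens upwards and `-a / b` is its vertex.
  set c := P (-a / b) with hc
  have hc0 : 0 < c := hP _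
  have hcP (x : ℝ) : c ≤ P x := by
    have : P x - c = -2 * b * (x + a / b) ^ 2 := by
      have hb' := hb.ne
      simp only [hc, hPdef]
      field_simp
      ring
    nlinarith [mul_nonneg (neg_nonneg.2 hb.le) (sq_nonneg (x + a / b))]
  set M := 1 + 4 * |a| - 2 * b with hM
  have hPM {x : ℝ} (hx : x ∈ Icc (-1 : ℝ) 1) : P x ≤ M := by
    have h1 : |x| ≤ 1 := abs_le.2 hx
    have h2 : -(a * x) ≤ |a| := by
      have := neg_abs_le (a * x)
      rw [abs_mul] at this
      nlinarith [abs_nonneg a]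
    have h3 : x ^ 2 ≤ 1 := (sq_le_one_iff_abs_le_one x).2 h1
    simp only [hPdef, hM]
    nlinarith
  have hM0 : 0 < M := (hP 0).trans_le (hPM (by simp))
  let h : ContDiffBump (0 : ℝ) := ⟨1, 2, one_pos, one_lt_two⟩
  have hh : ContDiff ℝ 1 h := h.contDiff
  obtain ⟨C, hC⟩ := h.hasCompactSupport.deriv.exists_bound_of_continuous (hh.continuous_deriv le_rfl)
  -- Test with `χ(x) = h(x / R)`: the gradient term is at most `(C / R)² / c` on an interval of
  -- length `4R`, while the negative term contributes at least a fixed amount on `[-1, 1]`.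
  have key {R : ℝ} (hR : 1 ≤ R) : 0 ≤ 4 * C ^ 2 / c / R + 8 * b / M ^ 2 := by
    have hR0 : 0 < R := by linarith
    set χ : ℝ → ℝ := fun x => h (x / R) with hχ
    have hχd : ContDiff ℝ 1 χ := by fun_prop
    have hχs {x : ℝ} (hx : x ∉ Icc (-(2 * R)) (2 * R)) : χ x = 0 := by
      refine h.zero_of_le_dist ?_
      rw [dist_zero_right, Real.norm_eq_abs, abs_div, abs_of_pos hR0, le_div_iff₀ hR0]
      by_contra! hn
      exact hx (abs_le.1 hn.le)
    have hχc : HasCompactSupport χ := HasCompactSupport.intro isCompact_Icc fun x hx => hχs hx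
    have hχ' (x) : deriv χ x = deriv h (x / R) / R := by
      have := ((hh.differentiable one_ne_zero (x / R)).hasDerivAt.comp x
        ((hasDerivAt_id' x).div_const R)).deriv
      rw [mul_one_div] at this
      exact this
    have hχs' {x : ℝ} (hx : x ∉ Icc (-(2 * R)) (2 * R)) : deriv χ x = 0 := by
      refine image_eq_zero_of_notMem_tsupport fun hn => hx ?_
      have hsub : tsupport χ ⊆ Icc (-(2 * R)) (2 * R) :=
        closure_minimal (fun y hy => by_contra fun hy' => hy (hχs hy')) isClosed_Icc
      exact hsub (tsupport_deriv_subset hn)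
    refine (hS χ hχd hχc).trans ?_
    have e : 4 * C ^ 2 / c / R + 8 * b / M ^ 2 =
        ∫ x, ((Icc (-(2 * R)) (2 * R)).indicator (fun _ => (C / R) ^ 2 / c) x +
          (Icc (-1 : ℝ) 1).indicator (fun _ => 4 * b / M ^ 2) x) := by
      rw [integral_add, integral_indicator_const _ measurableSet_Icc,
        integral_indicator_const _ measurableSet_Icc]
      · simp only [Measure.real, Real.volume_Icc, smul_eq_mul]
        rw [ENNReal.toReal_ofReal (by linarith), ENNReal.toReal_ofReal (by norm_num)]
        field_simp
        ring
      · exact (integrable_indicator_iff measurableSet_Icc).2 (by simp)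
      · exact (integrable_indicator_iff measurableSet_Icc).2 (by simp)
    rw [e]
    refine integral_mono (Continuous.integrable_of_hasCompactSupport ?_
      (HasCompactSupport.intro (isCompact_Icc (a := -(2 * R)) (b := 2 * R)) fun x hx => by
        simp [hχs hx, hχs' hx])) (Integrable.add
          ((integrable_indicator_iff measurableSet_Icc).2 (by simp))
          ((integrable_indicator_iff measurableSet_Icc).2 (by simp))) fun x => add_le_add ?_ ?_
    · have := hχd.continuous_deriv le_rfl
      have := hχd.continuous
      exact (Continuous.div (by fun_prop) hPc fun x => (hP x).ne').add
        (Continuous.div (by fun_prop) (hPc.pow 2) fun x => (pow_pos (hP x) 2).ne')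
    · by_cases hx : x ∈ Icc (-(2 * R)) (2 * R)
      · rw [indicator_of_mem hx]
        have h1 : deriv χ x ^ 2 ≤ (C / R) ^ 2 := by
          rw [hχ', div_pow, div_pow]
          gcongr 1
          exact sq_le_sq' (abs_le.1 (hC _)).1 (abs_le.1 (hC _)).2
        exact div_le_div₀ (by positivity) h1 hc0 (hcP x)
      · simp [indicator_of_notMem hx, hχs' hx]
    · by_cases hx : x ∈ Icc (-1 : ℝ) 1
      · rw [indicator_of_mem hx]
        have h1 : χ x = 1 := by
          refine h.one_of_mem_closedBall ?_
          rw [Metric.mem_closedBall, dist_zero_right, Real.norm_eq_abs, abs_div, abs_of_pos hR0,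
            div_le_iff₀ hR0]
          have := abs_le.2 hx
          change |x| ≤ 1 * R
          linarith
        rw [h1, one_pow, mul_one, div_le_div_iff₀ (pow_pos (hP x) 2) (by positivity)]
        have : P x ^ 2 ≤ M ^ 2 := pow_le_pow_left₀ (hP x).le (hPM hx) 2
        nlinarith
      · rw [indicator_of_notMem hx]
        exact div_nonpos_of_nonpos_of_nonneg
          (mul_nonpos_of_nonpos_of_nonneg (by linarith) (sq_nonneg _)) (sq_nonneg _)
  set D := 4 * C ^ 2 / c with hD
  set e := -(8 * b / M ^ 2) with he
  have hD0 : 0 ≤ D := by positivity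
  have he0 : 0 < e := neg_pos.2 (div_neg_of_neg_of_pos (by linarith) (by positivity))
  have hq : 0 ≤ D / e := by positivity
  -- This radius makes `D / R < e`.
  have h1 := key (R := D / e + 1) (by linarith)
  have h2 : e ≤ D / (D / e + 1) := by linarith
  rw [le_div_iff₀ (by positivity), mul_add, mul_div_cancel₀ _ he0.ne'] at h2
  linarith

theorem eq_zero_of_quadratic_pos {a b : ℝ} (hP : ∀ x : ℝ, 0 < 1 - 4 * a * x - 2 * b * x ^ 2)
    (hb : 0 ≤ b) : a = 0 ∧ b = 0 := by
  have hb0 : b = 0 := by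
    by_contra hne
    have hb' : 0 < b := lt_of_le_of_ne hb (Ne.symm hne)
    -- Adding the values at two opposite points removes the linear term; here `b x² = 1/b + 2 + b >
    -- 2`.
    have h1 := hP (1 / b + 1)
    have h2 := hP (-(1 / b + 1))
    have h3 : b * (1 / b + 1) ^ 2 = 1 / b + 2 + b := by field_simp; ring
    have h4 : 0 < 1 / b := by positivity
    nlinarith
  refine ⟨?_, hb0⟩
  by_contra ha
  have h := hP (1 / (4 * a))
  rw [hb0] at h
  field_simp at h
  norm_num at h

/-- Since `J' = -4(a + bη)`, the first square in the integrand is that of `(uJ)' = χ'`; the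
substitution removes the cross term. -/
theorem lineIntegrand_div_charJac (h : IsCharacteristicallyAffine φ) {χ : ℝ → ℝ}
    (hχ : ContDiff ℝ 1 χ) (s η : ℝ) :
    lineIntegrand φ (fun η => χ η / charJac φ η s) s η = deriv χ η ^ 2 / charJac φ η s +
      4 * fderiv ℝ (burgers φ) (0, s) (0, 1) * χ η ^ 2 / charJac φ η s ^ 2 := by
  have hJ := h.charJac_pos η s
  have hJd : HasDerivAt (fun η => charJac φ η s) (-4 * (fderiv ℝ φ (0, s) (0, 1) +
      fderiv ℝ (burgers φ) (0, s) (0, 1) * η)) η := by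
    refine ((((hasDerivAt_id' η).const_mul (4 * fderiv ℝ φ (0, s) (0, 1))).const_sub 1).sub
      ((hasDerivAt_pow 2 η).const_mul (2 * fderiv ℝ (burgers φ) (0, s) (0, 1)))).congr_deriv ?_
    push_cast
    ring
  rw [lineIntegrand, ((hχ.differentiable one_ne_zero η).hasDerivAt.fun_div hJd hJ.ne').deriv]
  field_simp
  ring

theorem IsPerimeterMinimizer.fderiv_axis_eq_zero (hφ : ContDiff ℝ 2 φ)
    (hmin : IsPerimeterMinimizer (X₁Subgraph φ) univ) (s : ℝ) :
    fderiv ℝ φ (0, s) (0, 1) = 0 ∧ fderiv ℝ (burgers φ) (0, s) (0, 1) = 0 := by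
  have h := hmin.isCharacteristicallyAffine hφ
  refine eq_zero_of_quadratic_pos (fun η => h.charJac_pos η s)
    (nonneg_of_quadratic_stability (fun η => h.charJac_pos η s) fun χ hχ hχc => ?_)
  have hJ : ContDiff ℝ 1 fun η => charJac φ η s := by unfold charJac; fun_prop
  have := hmin.integral_lineIntegrand_nonneg hφ (u := fun η => χ η / charJac φ η s)
    (hχ.div hJ fun η => (h.charJac_pos η s).ne')
    (HasCompactSupport.intro hχc.isCompact fun η hη => by
      simp [image_eq_zero_of_notMem_tsupport hη]) s
  simp only [lineIntegrand_div_charJac h hχ] at this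
  exact this

theorem IsPerimeterMinimizer.exists_affine (hφ : ContDiff ℝ 2 φ)
    (hmin : IsPerimeterMinimizer (X₁Subgraph φ) univ) :
    ∃ w c : ℝ, ∀ η τ : ℝ, φ (η, τ) = w * η + c := by
  have h := hmin.isCharacteristicallyAffine hφ
  have hconst {f : ℝ × ℝ → ℝ} (hf : ContDiff ℝ 1 f) (h0 : ∀ s, fderiv ℝ f (0, s) (0, 1) = 0)
      (s : ℝ) : f (0, s) = f (0, 0) := by
    have hd (s : ℝ) : HasDerivAt (fun s : ℝ => f (0, s)) 0 s := by
      simpa [h0] using hasDerivAt_comp_curve hf (hasDerivAt_const s (0 : ℝ)) (hasDerivAt_id' s)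
    exact is_const_of_deriv_eq_zero (fun s => (hd s).differentiableAt) (fun s => (hd s).deriv) s 0
  refine ⟨burgers φ (0, 0), φ (0, 0), fun η τ => ?_⟩
  obtain ⟨h1, h2⟩ := h.apply_foot (η, τ)
  rw [hconst h.contDiff_one fun s => (hmin.fderiv_axis_eq_zero hφ s).1] at h1
  rw [hconst h.contDiff_burgers fun s => (hmin.fderiv_axis_eq_zero hφ s).2] at h2
  rw [h2]
  linarith

theorem isVerticalPlane_X₁Graph {w c : ℝ} (h : ∀ η τ : ℝ, φ (η, τ) = w * η + c) :
    IsVerticalPlane (X₁Graph φ) := by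
  refine ⟨1, -w, c, by simp, ?_⟩
  ext p
  simp only [X₁Graph, mem_range, Prod.exists, h, mem_ofPred_eq, mul, e₁]
  constructor
  · rintro ⟨η, τ, rfl⟩
    simp
  · intro hp
    refine ⟨p.2.1, p.2.2 - 2 * p.2.1 * p.1, ?_⟩
    have : w * p.2.1 + c = p.1 := by linarith
    rw [this]
    ext <;> simp
    ring

end Heisenberg

theorem theorem5p3 (φ : ℝ × ℝ → ℝ) (hφ : ContDiff ℝ 2 φ)
    (hmin : Heisenberg.IsPerimeterMinimizer (Heisenberg.X₁Subgraph φ) Set.univ) :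
    Heisenberg.IsVerticalPlane (Heisenberg.X₁Graph φ) ∧
      ∃ w c : ℝ, ∀ η τ : ℝ, φ (η, τ) = w * η + c := by
  obtain ⟨w, c, h⟩ := hmin.exists_affine hφ
  exact ⟨Heisenberg.isVerticalPlane_X₁Graph h, w, c, h⟩
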